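/- Let $0<L<2\pi$, $\mathbb T^2=\mathbb R^2/(L\mathbb Z)^2$, and for $k\in\mathbb Z^2$ put $|k|=\max\{|k_1|,|k_2|\}$, $e_k(x)=L^{-1}e^{i(2\pi/L)k\cdot x}$ and $\lambda_k=(2\pi/L)^2(k_1^2+k_2^2)-1$ (so $\lambda_0=-1$ and $\lambda_k>0$ for $k\neq0$). For $N\in\mathbb N_0$ let $$C_N=\frac1{L^2}\sum_{|k|\le N}\frac1{|\lambda_k|}.$$ Identify $\mathbb R^{(2N+1)^2}$ isometrically with the families $z=(z_k)_{|k|\le N}$ of complex numbers satisfying $z_{-k}=\overline{z_k}$, with norm $\|z\|^2=\sum_{|k|\le N}|z_k|^2$ (gradients and Lebesgue measure $dz$ are taken in this sense), and let $\phi_z=\sum_{|k|\le N}z_ke_k$, a real function on $\mathbb T^2$. Define $$w_N(y)=\frac14\int_{\mathbb T^2}\bigl(\phi_y^4-6C_N\phi_y^2+3C_N^2\bigr)\,dx,$$ and let $\gamma=\gamma_N$ be the Gaussian probability measure on $\mathbb R^{(2N+1)^2}$ whose density is proportional to $\exp\bigl\{-\frac12|\lambda_0|y_0^2-\frac12\sum_{0<|k|\le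 N}\lambda_k|y_k|^2\bigr\}$. For $\varepsilon\in(0,1)$ let $$V_N(z)=\frac12\int_{\mathbb T^2}\bigl(\|\nabla\phi_z\|^2-\phi_z^2\bigr)\,dx+\frac14\int_{\mathbb T^2}\bigl(\phi_z^4-6\varepsilon C_N\phi_z^2+3\varepsilon^2C_N^2\bigr)\,dx.$$ For $\delta\in(0,1)$, $s<0$ and $r>0$ let $A$ and $B$ be the sets of those $z$ for which the mean $\bar\phi_z=L^{-2}\int_{\mathbb T^2}\phi_z\,dx$ lies in $[-1-\delta,-1+\delta]$, respectively in $[1-\delta,1+\delta]$, and $$\|\phi_z-\bar\phi_z\|_{H^s}=\Bigl(\sum_{0<|k|\le N}(1+k_1^2+k_2^2)^s|z_k|^2\Bigr)^{1/2}\le r\sqrt{\varepsilon\log(\varepsilon^{-1})}.$$ Let $$\operatorname{cap}_A(B)=\varepsilon\inf_{h}\int_{(A\cup B)^c}\|\nabla h\|^2e^{-V_N(z)/\varepsilon}\,dz,$$ the infimum being over all functions $h$ in the Sobolev space $H^1$ with respect to the measure $e^{-V_N(z)/\varepsilon}dz$ ($h$ and its weak gradient are square integrable) such that $h=1$ a.e.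 in $A$ and $h=0$ a.e. in $B$. (i) There is a constant $C$, depending only on $L$, such that for all $N\ge0$ and all $\varepsilon\in(0,1)$ the function $e^{-\varepsilon w_N}$ is $\gamma$-integrable and $$\bigl|\mathbb E_\gamma[e^{-\varepsilon w_N}]-1\bigr|\le C\varepsilon.$$ (ii) For all $\delta\in(0,1)$, $s<0$ and $r>0$ there is a constant $c_+$, depending only on $L,\delta,s,r$, such that for all $N\ge0$ and all $\varepsilon\in(0,1)$ $$\operatorname{cap}_A(B)\le\sqrt{\frac{|\lambda_0|\varepsilon}{2\pi}}\;\prod_{0<|k|\le N}\sqrt{\frac{2\pi\varepsilon}{\lambda_k}}\;\bigl(1+c_+\varepsilon\bigr).$$ -/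

import Mathlib

open MeasureTheory

namespace AllenCahn

noncomputable section

/-- Wave vectors `k ∈ ℤ²` with `|k| = max {|k₁|, |k₂|} ≤ N`. -/
def freqs (N : ℕ) : Finset (ℤ × ℤ) :=
  Finset.Icc (-(N : ℤ)) N ×ˢ Finset.Icc (-(N : ℤ)) N

abbrev Freq (N : ℕ) : Type := {k : ℤ × ℤ // k ∈ freqs N}

theorem neg_mem_freqs {N : ℕ} {k : ℤ × ℤ} (hk : k ∈ freqs N) : -k ∈ freqs N := by
  simp only [freqs, Finset.mem_product, Finset.mem_Icc, Prod.fst_neg, Prod.snd_neg] at hk ⊢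
  omega

def Freq.opp {N : ℕ} (k : Freq N) : Freq N := ⟨-k.1, neg_mem_freqs k.2⟩

theorem Freq.opp_opp {N : ℕ} (k : Freq N) : k.opp.opp = k := by
  simp [Freq.opp]

/-- A half of `ℤ² \ {0}`, containing exactly one of `k`, `-k` for every `k ≠ 0`. -/
def IsPos (k : ℤ × ℤ) : Prop := 0 < k.1 ∨ (k.1 = 0 ∧ 0 < k.2)

instance (k : ℤ × ℤ) : Decidable (IsPos k) := by unfold IsPos; infer_instance

/-- `λ_k = (2π/L)² (k₁² + k₂²) - 1`, the eigenvalues of `-Δ - 1` on the torus of size `L`. -/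
def lam (L : ℝ) (k : ℤ × ℤ) : ℝ :=
  (2 * Real.pi / L) ^ 2 * ((k.1 : ℝ) ^ 2 + (k.2 : ℝ) ^ 2) - 1

/-- The renormalisation constant `C_N = L⁻² ∑_{|k| ≤ N} 1 / |λ_k|`. -/
def renormConst (L : ℝ) (N : ℕ) : ℝ := 1 / L ^ 2 * ∑ k ∈ freqs N, 1 / |lam L k|

/-- The configuration space `ℝ^{(2N+1)²}`, with its Euclidean norm and Lebesgue measure. -/
abbrev State (N : ℕ) : Type := EuclideanSpace ℝ (Freq N)

/-- The complex Fourier coefficients `z_k` of a configuration. The map `x ↦ (z_k)` is the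
isometric identification of `ℝ^{(2N+1)²}` with the families satisfying `z_{-k} = conj z_k`
(see `coef_opp` and `sum_sq_coef`): `z_0 = x_0`, and `z_k = (x_k + i x_{-k}) / √2` for `k` in
the positive half. -/
def coef {N : ℕ} (x : State N) (k : Freq N) : ℂ :=
  if k.1 = 0 then (x k : ℂ)
  else if IsPos k.1 then ((x k : ℂ) + (x k.opp : ℂ) * Complex.I) / (Real.sqrt 2 : ℂ)
  else ((x k.opp : ℂ) - (x k : ℂ) * Complex.I) / (Real.sqrt 2 : ℂ)

/-- The `L²`-normalised Fourier basis `e_k(p) = L⁻¹ exp(i (2π/L) k·p)`. -/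
def basisFun (L : ℝ) (k : ℤ × ℤ) (p : ℝ × ℝ) : ℂ :=
  (1 / L : ℂ) * Complex.exp (Complex.I * (((2 * Real.pi / L) * (k.1 * p.1 + k.2 * p.2) : ℝ) : ℂ))

/-- The real field `φ(p) = ∑_{|k| ≤ N} z_k e_k(p)` on the torus, as a doubly `L`-periodic
function on the plane; the imaginary part of the sum vanishes (see `field_eq`). -/
def field (L : ℝ) {N : ℕ} (x : State N) (p : ℝ × ℝ) : ℝ :=
  (∑ k : Freq N, coef x k * basisFun L k.1 p).re

/-- Integral over the torus `ℝ² / (Lℤ)²`, computed on the fundamental domain `[0,L]²`. -/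
def torusIntegral (L : ℝ) (f : ℝ × ℝ → ℝ) : ℝ :=
  ∫ p in Set.Icc (0 : ℝ) L ×ˢ Set.Icc (0 : ℝ) L, f p

/-- `‖∇φ(p)‖²` for a function of two real variables. -/
def gradSq (φ : ℝ × ℝ → ℝ) (p : ℝ × ℝ) : ℝ :=
  (deriv (fun t => φ (t, p.2)) p.1) ^ 2 + (deriv (fun t => φ (p.1, t)) p.2) ^ 2

/-- The renormalised potential
`V_N[φ] = ½ ∫ (‖∇φ‖² - φ²) + ¼ ∫ (φ⁴ - 6 ε C_N φ² + 3 ε² C_N²)`. -/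
def potentialOf (L ε : ℝ) (N : ℕ) (φ : ℝ × ℝ → ℝ) : ℝ :=
  1 / 2 * torusIntegral L (fun p => gradSq φ p - φ p ^ 2)
    + 1 / 4 * torusIntegral L (fun p =>
        φ p ^ 4 - 6 * ε * renormConst L N * φ p ^ 2 + 3 * ε ^ 2 * renormConst L N ^ 2)

/-- `V_N(z)`, the potential evaluated at the field with Fourier coefficients `z`. -/
def potential (L ε : ℝ) {N : ℕ} (z : State N) : ℝ := potentialOf L ε N (field L z)

/-- `w_N(y) = ¼ ∫ (φ⁴ - 6 C_N φ² + 3 C_N²)`, where `φ` is the field of `y`. -/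
def wick (L : ℝ) {N : ℕ} (y : State N) : ℝ :=
  1 / 4 * torusIntegral L (fun p =>
    field L y p ^ 4 - 6 * renormConst L N * field L y p ^ 2 + 3 * renormConst L N ^ 2)

/-- `g_N(y) = ½ |λ_0| y_0² + ½ ∑_{0 < |k| ≤ N} λ_k |y_k|²` (recall that `λ_k > 0` for `k ≠ 0`
when `0 < L < 2π`). -/
def quadForm (L : ℝ) {N : ℕ} (y : State N) : ℝ :=
  1 / 2 * ∑ k : Freq N, |lam L k.1| * ‖coef y k‖ ^ 2

/-- The Gaussian probability measure `dγ(y) = 𝒩⁻¹ e^{-g_N(y)} dy`, with `𝒩 = ∫ e^{-g_N(y)} dy`. -/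
def gauss (L : ℝ) (N : ℕ) : Measure (State N) :=
  (∫⁻ y : State N, ENNReal.ofReal (Real.exp (-quadForm L y)))⁻¹ •
    (volume : Measure (State N)).withDensity
      (fun y => ENNReal.ofReal (Real.exp (-quadForm L y)))

/-- `e^{-V_N(z)/ε} dz`. -/
def gibbs (L ε : ℝ) (N : ℕ) : Measure (State N) :=
  (volume : Measure (State N)).withDensity
    (fun z => ENNReal.ofReal (Real.exp (-potential L ε z / ε)))

/-- The spatial mean `L⁻² ∫ φ`. -/
def mean (L : ℝ) (φ : ℝ × ℝ → ℝ) : ℝ := 1 / L ^ 2 * torusIntegral L φ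

/-- The norm in the Sobolev space `H^s` of the oscillating part `φ_⊥ = φ - mean φ`, where `φ`
has Fourier coefficients `z_k`, `|k| ≤ N`. -/
def sobolevNormPerp (s : ℝ) {N : ℕ} (z : State N) : ℝ :=
  Real.sqrt (∑ k : Freq N with k.1 ≠ 0,
    (1 + (k.1.1 : ℝ) ^ 2 + (k.1.2 : ℝ) ^ 2) ^ s * ‖coef z k‖ ^ 2)

/-- Fields whose mean lies in `[m - δ, m + δ]` and whose oscillating part lies in the centred
ball `D_⊥` of radius `r √(ε log(1/ε))` of `H^s`. -/
def wellSet (L δ s r ε : ℝ) (N : ℕ) (m : ℝ) : Set (State N) :=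
  {z | mean L (field L z) ∈ Set.Icc (m - δ) (m + δ) ∧
    sobolevNormPerp s z ≤ r * Real.sqrt (ε * Real.log ε⁻¹)}

/-- The neighbourhood of the stable solution `-1`. -/
def setA (L δ s r ε : ℝ) (N : ℕ) : Set (State N) := wellSet L δ s r ε N (-1)

/-- The neighbourhood of the stable solution `1`. -/
def setB (L δ s r ε : ℝ) (N : ℕ) : Set (State N) := wellSet L δ s r ε N 1

/-- `G` is the weak (distributional) gradient of `h`. -/
def HasWeakGradient {N : ℕ} (h : State N → ℝ) (G : State N → State N) : Prop :=
  LocallyIntegrable h volume ∧ LocallyIntegrable G volume ∧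
    ∀ ψ : State N → ℝ, ContDiff ℝ (⊤ : ℕ∞) ψ → HasCompactSupport ψ → ∀ v : State N,
      ∫ x, h x * fderiv ℝ ψ x v = - ∫ x, ψ x * inner ℝ (G x) v

/-- `h` belongs to `𝓗_{A,B}` and has weak gradient `G`: `h` is in the Sobolev space `H¹` of the
reference measure `e^{-V_N/ε} dz`, `h = 1` in `A` and `h = 0` in `B`. -/
def IsAdmissible (L ε : ℝ) {N : ℕ} (A B : Set (State N))
    (h : State N → ℝ) (G : State N → State N) : Prop :=
  HasWeakGradient h G ∧ MemLp h 2 (gibbs L ε N) ∧ MemLp G 2 (gibbs L ε N) ∧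
    (∀ᵐ z ∂(volume : Measure (State N)), z ∈ A → h z = 1) ∧
    (∀ᵐ z ∂(volume : Measure (State N)), z ∈ B → h z = 0)

/-- The capacity
`cap_A(B) = ε inf_{h ∈ 𝓗_{A,B}} ∫_{(A ∪ B)ᶜ} ‖∇h‖² e^{-V_N(z)/ε} dz`, as an element of `[0,∞]`. -/
def capacity (L ε : ℝ) {N : ℕ} (A B : Set (State N)) : ENNReal :=
  ENNReal.ofReal ε *
    ⨅ (h : State N → ℝ) (G : State N → State N) (_ : IsAdmissible L ε A B h G),
      ∫⁻ z in (A ∪ B)ᶜ, ENNReal.ofReal (‖G z‖ ^ 2) ∂(gibbs L ε N)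

/-- The Fourier coefficients satisfy the reality condition. -/
theorem coef_opp {N : ℕ} (x : State N) (k : Freq N) :
    coef x k.opp = (starRingEnd ℂ) (coef x k) := by
  obtain ⟨⟨a, b⟩, hk⟩ := k
  by_cases h0 : ((a, b) : ℤ × ℤ) = 0
  · have h1 : (Freq.opp ⟨(a, b), hk⟩ : Freq N) = ⟨(a, b), hk⟩ := by
      apply Subtype.ext
      simp only [Freq.opp]
      rw [h0]; simp
    rw [h1]
    simp [coef, h0]
  · have h0' : ¬ (-(a, b) : ℤ × ℤ) = 0 := by simpa using h0
    have h2 := Freq.opp_opp (⟨(a, b), hk⟩ : Freq N)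
    by_cases hp : IsPos (a, b)
    · have hn : ¬ IsPos (-(a, b)) := by
        simp only [IsPos, Prod.fst_neg, Prod.snd_neg] at hp ⊢; omega
      simp only [coef, h2]
      simp only [Freq.opp, h0, h0', hp, hn, if_true, if_false]
      simp [sub_eq_add_neg]
    · have hn : IsPos (-(a, b)) := by
        simp only [Prod.mk_eq_zero] at h0
        simp only [IsPos, Prod.fst_neg, Prod.snd_neg] at hp ⊢; omega
      simp only [coef, h2]
      simp only [Freq.opp, h0, h0', hp, hn, if_true, if_false]
      simp

/-- The identification with complex Fourier coefficients is isometric. -/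
theorem sum_sq_coef {N : ℕ} (x : State N) : ∑ k : Freq N, ‖coef x k‖ ^ 2 = ‖x‖ ^ 2 := by
  have key : ∀ k : Freq N, ‖coef x k‖ ^ 2 = (x k ^ 2 + x k.opp ^ 2) / 2 := by
    intro k
    have hs : Real.sqrt 2 * Real.sqrt 2 = 2 := Real.mul_self_sqrt (by norm_num)
    rw [← Complex.normSq_eq_norm_sq]
    unfold coef
    split_ifs with h0 hp
    · have h1 : k.opp = k := by
        apply Subtype.ext
        simp only [Freq.opp]
        rw [h0]; simp
      rw [h1, Complex.normSq_ofReal]; ring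
    · rw [Complex.normSq_div, Complex.normSq_ofReal, hs, Complex.normSq_add_mul_I]
    · rw [Complex.normSq_div, Complex.normSq_ofReal, hs]
      have : (x k.opp : ℂ) - (x k : ℂ) * Complex.I
          = (x k.opp : ℂ) + ((-(x k) : ℝ) : ℂ) * Complex.I := by push_cast; ring
      rw [this, Complex.normSq_add_mul_I]; ring
  have hopp : ∑ k : Freq N, x k.opp ^ 2 = ∑ k : Freq N, x k ^ 2 :=
    Fintype.sum_equiv ⟨Freq.opp, Freq.opp, Freq.opp_opp, Freq.opp_opp⟩ _ _ (fun _ => rfl)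
  rw [EuclideanSpace.real_norm_sq_eq]
  simp only [key]
  rw [← Finset.sum_div, Finset.sum_add_distrib, hopp]
  ring

/-- The Fourier sum of a configuration is real. -/
theorem field_eq (L : ℝ) {N : ℕ} (x : State N) (p : ℝ × ℝ) :
    (field L x p : ℂ) = ∑ k : Freq N, coef x k * basisFun L k.1 p := by
  unfold field
  rw [← Complex.conj_eq_iff_re, map_sum]
  refine Fintype.sum_equiv ⟨Freq.opp, Freq.opp, Freq.opp_opp, Freq.opp_opp⟩ _ _ ?_
  intro k
  simp only [Equiv.coe_fn_mk]
  rw [coef_opp, map_mul]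
  congr 1
  simp only [basisFun, Freq.opp, map_mul, map_div₀, map_one, Complex.conj_ofReal,
    ← Complex.exp_conj, Complex.conj_I, Prod.fst_neg, Prod.snd_neg]
  congr 2
  push_cast
  ring

end

end AllenCahn

/-!
The first part is Nelson's estimate for the `φ⁴` measure in two dimensions. The function
`ε ↦ e^{-ε w}` is convex and `w` has mean zero under the Gaussian measure, so
`0 ≤ E e^{-ε w} - 1 ≤ ε (E e^{-w} - 1)`, and it suffices to bound `E e^{-w_N}` uniformly in `N`
(`exists_integral_exp_neg_wick_le`). Let `w_M` be the same quartic for the field truncated at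
frequency `M`, with its own renormalisation constant. Completing the square gives
`w_M ≥ -(3/2) L² C_M²` (`eval_wickTrunc_ge`), and `C_M` grows only like `log M`
(`exists_renormConst_two_pow_le`). Hence `w_N` can be very negative only if it differs by at least
one from some `w_{2^j}` with `j` large, and this is very unlikely, since all moments of `w_N - w_M`
are small (`exists_moment_sub_wickTrunc_le`). Trading the thresholds of order `j²` against moments
of order `j` gives a convergent series (`exp_neg_le_sum`, `exists_summable_dyadic`).

The moment bound is Gaussian hypercontractivity. It is proved for polynomials: an element of the
`n`-th chaos is an eigenvector of the number operator, and testing this equation against a power of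
the element, followed by integration by parts and Young's inequality, bounds its moments by those of
its gradient, which lies in the chaos of order `n - 1` (`chaos_moment_le`). Four steps leave only
the constant fourth derivative (`chaos_four_moment_le`). For `w_N - w_M` its squared norm is
bounded by a sum over frequencies `k₁, …, k₄` in resonance, at least one of them above `M`, of
products of covariances of order `|k|⁻²`; such sums decay like a power of `M`
(`exists_sum_fourth_deriv_le`).

For the capacity, the test function depends on the zero mode `z₀ = L · mean` only. Its derivative
is proportional to `e^{-z₀²/2ε}` times a cutoff to the gap between the two wells. The square of this
Gaussian reverses the sign of the unstable direction in `e^{-V/ε}`, so after `z = √ε y` the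
Dirichlet form becomes the Gaussian partition function times `E e^{-ε w}`, to which the first part
applies (`lintegral_testGrad_le`, `capacity_le_of_mean`). The cutoff costs a relative error `O(ε)`
(`exists_div_cutMass_sq_le`).
-/

namespace AllenCahn

noncomputable section

/-! ### Moments of homogeneous Gaussian chaos -/

theorem young_pow {x y : ℝ} (hx : 0 ≤ x) (hy : 0 ≤ y) (q : ℕ) :
    (q + 1) * (x ^ q * y) ≤ q * x ^ (q + 1) + y ^ (q + 1) := by
  rcases hx.eq_or_lt with rfl | hx
  · rcases Nat.eq_zero_or_pos q with rfl | hq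
    · simp
    · rw [zero_pow hq.ne', zero_pow (by omega)]
      have := pow_nonneg hy (q + 1)
      linarith
  · have hb := one_add_mul_le_pow (a := y / x - 1)
      (by have := div_nonneg hy hx.le; linarith) (q + 1)
    have hp : 0 < x ^ (q + 1) := by positivity
    have := mul_le_mul_of_nonneg_left hb hp.le
    rw [show (1 + (y / x - 1)) = y / x by ring, div_pow, mul_div_cancel₀ _ hp.ne'] at this
    have e : x ^ (q + 1) * (1 + ((q + 1 : ℕ) : ℝ) * (y / x - 1))
        = (q + 1) * (x ^ q * y) - q * x ^ (q + 1) := by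
      push_cast
      field_simp
      ring
    linarith

section Chaos

open MvPolynomial

variable {ι : Type*} [Fintype ι]

/-- The expectation functional, on polynomials, of independent centred Gaussian variables with
variances `v i`, characterised by positivity and by integration by parts (Stein's identity). -/
structure IsGaussianExpectation (v : ι → ℝ) (E : MvPolynomial ι ℝ →ₗ[ℝ] ℝ) : Prop where
  map_one : E 1 = 1
  nonneg : ∀ p, (∀ y : ι → ℝ, 0 ≤ eval y p) → 0 ≤ E p
  stein : ∀ i p, E (X i * p) = v i * E (pderiv i p)

/-- The number operator `∑ᵢ (Xᵢ ∂ᵢ - vᵢ ∂ᵢ²)`, minus the generator of the Ornstein–Uhlenbeck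
semigroup. -/
def numberOp (v : ι → ℝ) : MvPolynomial ι ℝ →ₗ[ℝ] MvPolynomial ι ℝ :=
  ∑ i, (LinearMap.mulLeft ℝ (X i) ∘ₗ (pderiv i).toLinearMap
    - v i • ((pderiv i).toLinearMap ∘ₗ (pderiv i).toLinearMap))

theorem numberOp_apply (v : ι → ℝ) (p : MvPolynomial ι ℝ) :
    numberOp v p = ∑ i, (X i * pderiv i p - v i • pderiv i (pderiv i p)) := by
  simp [numberOp, LinearMap.sum_apply]

/-- The homogeneous chaos of order `n`: the eigenspace of the number operator at `n`. -/
def chaos (v : ι → ℝ) (n : ℕ) : Submodule ℝ (MvPolynomial ι ℝ) :=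
  LinearMap.ker (numberOp v - (n : ℝ) • (LinearMap.id : MvPolynomial ι ℝ →ₗ[ℝ] MvPolynomial ι ℝ))

theorem mem_chaos {v : ι → ℝ} {n : ℕ} {p : MvPolynomial ι ℝ} :
    p ∈ chaos v n ↔ numberOp v p = (n : ℝ) • p := by
  simp [chaos, LinearMap.mem_ker, sub_eq_zero]

theorem pderiv_pderiv_comm {σ : Type*} (i j : σ) (p : MvPolynomial σ ℝ) :
    pderiv i (pderiv j p) = pderiv j (pderiv i p) := by
  classical
  have h : ⁅(pderiv i : Derivation ℝ (MvPolynomial σ ℝ) (MvPolynomial σ ℝ)),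
      (pderiv j : Derivation ℝ (MvPolynomial σ ℝ) (MvPolynomial σ ℝ))⁆ = 0 := by
    apply MvPolynomial.derivation_ext
    intro k
    rw [Derivation.commutator_apply]
    simp [pderiv_X, Pi.single_apply, apply_ite]
  have := congrArg (fun D => D p) h
  simpa [Derivation.commutator_apply, sub_eq_zero] using this

theorem pderiv_mem_chaos {v : ι → ℝ} {n : ℕ} {p : MvPolynomial ι ℝ} (hp : p ∈ chaos v (n + 1))
    (j : ι) : pderiv j p ∈ chaos v n := by
  classical
  rw [mem_chaos] at hp ⊢
  have h : pderiv j (numberOp v p) = numberOp v (pderiv j p) + pderiv j p := by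
    rw [numberOp_apply, numberOp_apply, map_sum]
    have : ∀ i, pderiv j (X i * pderiv i p - v i • pderiv i (pderiv i p))
        = (X i * pderiv i (pderiv j p) - v i • pderiv i (pderiv i (pderiv j p)))
          + (if i = j then pderiv i p else 0) := by
      intro i
      rw [map_sub, pderiv_mul, (pderiv j).map_smul, pderiv_pderiv_comm j i,
        pderiv_pderiv_comm j i, pderiv_X, pderiv_pderiv_comm j i p]
      by_cases hij : i = j
      · subst hij; simp; ring
      · simp [hij]
    simp only [this]
    rw [Finset.sum_add_distrib]
    simp
  rw [hp, (pderiv j).map_smul] at h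
  rw [← sub_eq_iff_eq_add.mpr h]
  push_cast
  rw [add_smul, one_smul, add_sub_cancel_right]

namespace IsGaussianExpectation

variable {v : ι → ℝ} {E : MvPolynomial ι ℝ →ₗ[ℝ] ℝ} (hE : IsGaussianExpectation v E)
include hE

omit [Fintype ι] in
theorem mono {p q : MvPolynomial ι ℝ} (h : ∀ y : ι → ℝ, eval y p ≤ eval y q) : E p ≤ E q := by
  have := hE.nonneg (q - p) (fun y => by simpa using h y)
  rw [map_sub] at this
  linarith

/-- The Dirichlet form of the number operator. -/
theorem mul_numberOp (p q : MvPolynomial ι ℝ) :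
    E (q * numberOp v p) = ∑ i, v i * E (pderiv i q * pderiv i p) := by
  rw [numberOp_apply, Finset.mul_sum, map_sum]
  refine Finset.sum_congr rfl fun i _ => ?_
  have h1 : q * (X i * pderiv i p - v i • pderiv i (pderiv i p))
      = X i * (q * pderiv i p) - v i • (q * pderiv i (pderiv i p)) := by
    rw [mul_sub, mul_smul_comm]; ring
  rw [h1, map_sub, hE.stein, pderiv_mul, map_add, map_smul, smul_eq_mul]
  ring

theorem eq_zero_of_mem_chaos {n : ℕ} {p : MvPolynomial ι ℝ} (hp : p ∈ chaos v (n + 1)) :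
    E p = 0 := by
  have h := hE.mul_numberOp p 1
  rw [mem_chaos] at hp
  rw [hp] at h
  simp only [one_mul, map_smul, smul_eq_mul, Derivation.map_one_eq_zero, zero_mul, map_zero,
    mul_zero, Finset.sum_const_zero, mul_eq_zero] at h
  rcases h with h | h
  · exact absurd h (by positivity)
  · exact h

/-- Testing the eigenvalue equation of each `F j` against `S ^ q * F j`, where
`S = ∑ w_j F_j²`, and bounding `∇S` by Cauchy–Schwarz. -/
theorem chaos_energy_le (hv : ∀ i, 0 ≤ v i) {J : Type*} [Fintype J] {w : J → ℝ}
    (hw : ∀ j, 0 ≤ w j) {F : J → MvPolynomial ι ℝ} {n : ℕ} (hF : ∀ j, F j ∈ chaos v n) (q : ℕ) :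
    (n : ℝ) * E ((∑ j, C (w j) * F j ^ 2) ^ (q + 1)) ≤
      (2 * q + 1) * E ((∑ j, C (w j) * F j ^ 2) ^ q *
        ∑ i, ∑ j, C (v i * w j) * pderiv i (F j) ^ 2) := by
  classical
  set S := ∑ j, C (w j) * F j ^ 2 with hS
  set T := ∑ i, ∑ j, C (v i * w j) * pderiv i (F j) ^ 2 with hT
  have hS0 : ∀ y : ι → ℝ, 0 ≤ eval y S := by
    intro y
    simp only [hS, map_sum, map_mul, map_pow, eval_C]
    exact Finset.sum_nonneg fun j _ => mul_nonneg (hw j) (sq_nonneg _)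
  let R : ι → MvPolynomial ι ℝ := fun i => ∑ j, C (w j) * (F j * pderiv i (F j))
  have hdS : ∀ i, pderiv i S = C 2 * R i := by
    intro i
    simp only [hS, R, map_sum, Finset.mul_sum]
    refine Finset.sum_congr rfl fun j _ => ?_
    rw [pderiv_C_mul, pow_two, pderiv_mul]
    simp only [map_ofNat]
    ring
  -- the expectation of `S ^ (q + 1)`, after integration by parts
  have h1 : (n : ℝ) * E (S ^ (q + 1)) = E (S ^ q * T)
      + ∑ i, v i * E (C (2 * q : ℝ) * S ^ (q - 1) * R i ^ 2) := by
    have e1 : (n : ℝ) * E (S ^ (q + 1)) = ∑ j, w j * E ((S ^ q * F j) * numberOp v (F j)) := by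
      rw [pow_succ]
      conv_lhs => rw [hS, Finset.mul_sum, map_sum, Finset.mul_sum, ← hS]
      refine Finset.sum_congr rfl fun j _ => ?_
      rw [mem_chaos.1 (hF j), mul_smul_comm, map_smul, smul_eq_mul]
      have : S ^ q * (C (w j) * F j ^ 2) = w j • (S ^ q * F j * F j) := by
        rw [smul_eq_C_mul]; ring
      rw [this, map_smul, smul_eq_mul]; ring
    have e2 : ∀ j, w j * E ((S ^ q * F j) * numberOp v (F j))
        = ∑ i, (E (S ^ q * (C (v i * w j) * pderiv i (F j) ^ 2))
          + v i * E (C (2 * q : ℝ) * S ^ (q - 1) * R i * (C (w j) * (F j * pderiv i (F j))))) := by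
      intro j
      rw [hE.mul_numberOp, Finset.mul_sum]
      refine Finset.sum_congr rfl fun i _ => ?_
      have hd : pderiv i (S ^ q * F j) * pderiv i (F j)
          = S ^ q * pderiv i (F j) ^ 2
            + C (2 * q : ℝ) * S ^ (q - 1) * R i * (F j * pderiv i (F j)) := by
        rw [pderiv_mul, Derivation.leibniz_pow, hdS, nsmul_eq_mul, smul_eq_mul, C_mul]
        simp only [map_ofNat, map_natCast]
        ring
      have a1 : S ^ q * (C (v i * w j) * pderiv i (F j) ^ 2)
          = (v i * w j) • (S ^ q * pderiv i (F j) ^ 2) := by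
        rw [smul_eq_C_mul]; ring
      have a2 : C (2 * q : ℝ) * S ^ (q - 1) * R i * (C (w j) * (F j * pderiv i (F j)))
          = w j • (C (2 * q : ℝ) * S ^ (q - 1) * R i * (F j * pderiv i (F j))) := by
        rw [smul_eq_C_mul]; ring
      rw [hd, map_add, a1, a2, map_smul, map_smul, smul_eq_mul, smul_eq_mul]
      ring
    rw [e1, Finset.sum_congr rfl fun j _ => e2 j, Finset.sum_comm]
    simp only [Finset.sum_add_distrib]
    congr 1
    · rw [hT, Finset.mul_sum, map_sum]
      refine Finset.sum_congr rfl fun i _ => ?_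
      rw [Finset.mul_sum, map_sum]
    · refine Finset.sum_congr rfl fun i _ => ?_
      rw [← Finset.mul_sum, ← map_sum, ← Finset.mul_sum]
      congr 2
      simp only [R]
      ring
  have h2 : ∑ i, v i * E (C (2 * q : ℝ) * S ^ (q - 1) * R i ^ 2) ≤ 2 * q * E (S ^ q * T) := by
    have : ∑ i, v i * E (C (2 * q : ℝ) * S ^ (q - 1) * R i ^ 2)
        = E (∑ i, C (v i) * (C (2 * q : ℝ) * S ^ (q - 1) * R i ^ 2)) := by
      rw [map_sum]
      refine Finset.sum_congr rfl fun i _ => ?_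
      rw [← smul_eq_C_mul (a := v i), map_smul, smul_eq_mul]
    rw [this, ← smul_eq_mul (2 * q : ℝ) (E _), ← map_smul]
    refine hE.mono fun y => ?_
    rcases Nat.eq_zero_or_pos q with rfl | hq
    · simp
    obtain ⟨m, rfl⟩ : ∃ m, q = m + 1 := ⟨q - 1, by omega⟩
    have hcs : ∀ i, (eval y (R i)) ^ 2 ≤
        eval y S * ∑ j, w j * (eval y (pderiv i (F j))) ^ 2 := by
      intro i
      have := Finset.sum_mul_sq_le_sq_mul_sq Finset.univ
        (fun j => Real.sqrt (w j) * eval y (F j))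
        (fun j => Real.sqrt (w j) * eval y (pderiv i (F j)))
      simp only [R, hS, map_sum, map_mul, map_pow, eval_C]
      have hsq : ∀ (j : J) (t : ℝ), (Real.sqrt (w j) * t) ^ 2 = w j * t ^ 2 := fun j t => by
        rw [mul_pow, Real.sq_sqrt (hw j)]
      have hmul : ∀ (j : J) (t u : ℝ),
          Real.sqrt (w j) * t * (Real.sqrt (w j) * u) = w j * (t * u) := fun j t u => by
        linear_combination (t * u) * Real.mul_self_sqrt (hw j)
      simpa only [hsq, hmul] using this
    simp only [map_sum, map_mul, map_pow, eval_C, smul_eval, hT, Nat.add_sub_cancel]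
    rw [Finset.mul_sum, Finset.mul_sum]
    refine Finset.sum_le_sum fun i _ => ?_
    have hnn : 0 ≤ v i * (2 * ((m + 1 : ℕ) : ℝ) * eval y S ^ m) :=
      mul_nonneg (hv i) (mul_nonneg (by positivity) (pow_nonneg (hS0 y) _))
    have := mul_le_mul_of_nonneg_left (hcs i) hnn
    calc _ = v i * (2 * ((m + 1 : ℕ) : ℝ) * eval y S ^ m) * eval y (R i) ^ 2 := by ring
      _ ≤ _ := this
      _ = _ := by
        simp only [Finset.mul_sum]
        refine Finset.sum_congr rfl fun j _ => ?_
        ring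
  rw [h1]
  linarith

/-- One step of Gaussian hypercontractivity: the moments of a family in the chaos of order `n`
are controlled by those of its gradient. -/
theorem chaos_moment_le (hv : ∀ i, 0 ≤ v i) {J : Type*} [Fintype J] {w : J → ℝ}
    (hw : ∀ j, 0 ≤ w j) {F : J → MvPolynomial ι ℝ} {n : ℕ} (hn : 0 < n)
    (hF : ∀ j, F j ∈ chaos v n) (q : ℕ) :
    E ((∑ j, C (w j) * F j ^ 2) ^ (q + 1)) ≤ ((2 * q + 1) / n) ^ (q + 1) *
      E ((∑ i, ∑ j, C (v i * w j) * pderiv i (F j) ^ 2) ^ (q + 1)) := by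
  have h1 := hE.chaos_energy_le hv hw hF q
  set S := ∑ j, C (w j) * F j ^ 2 with hS
  set T := ∑ i, ∑ j, C (v i * w j) * pderiv i (F j) ^ 2 with hT
  have hS0 : ∀ y : ι → ℝ, 0 ≤ eval y S := by
    intro y
    simp only [hS, map_sum, map_mul, map_pow, eval_C]
    exact Finset.sum_nonneg fun j _ => mul_nonneg (hw j) (sq_nonneg _)
  have hT0 : ∀ y : ι → ℝ, 0 ≤ eval y T := by
    intro y
    simp only [hT, map_sum, map_mul, map_pow, eval_C]
    exact Finset.sum_nonneg fun i _ => Finset.sum_nonneg fun j _ =>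
      mul_nonneg (mul_nonneg (hv i) (hw j)) (sq_nonneg _)
  have hn' : (0 : ℝ) < n := by exact_mod_cast hn
  set c : ℝ := (2 * q + 1) / n with hc
  have hc0 : 0 ≤ c := by positivity
  have h2 : (q + 1 : ℝ) * (c * E (S ^ q * T)) ≤
      q * E (S ^ (q + 1)) + c ^ (q + 1) * E (T ^ (q + 1)) := by
    have : E (((q + 1 : ℝ) * c) • (S ^ q * T)) ≤
        E ((q : ℝ) • S ^ (q + 1) + (c ^ (q + 1)) • T ^ (q + 1)) := by
      refine hE.mono fun y => ?_
      have := young_pow (hS0 y) (mul_nonneg hc0 (hT0 y)) q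
      simp only [smul_eval, map_mul, map_pow, map_add]
      rw [mul_pow] at this
      calc _ = (q + 1 : ℝ) * (eval y S ^ q * (c * eval y T)) := by ring
        _ ≤ _ := this
    simp only [map_smul, map_add, smul_eq_mul] at this
    linarith
  have h3 : E (S ^ (q + 1)) ≤ c * E (S ^ q * T) := by
    rw [hc, div_mul_eq_mul_div, le_div_iff₀ hn']
    linarith
  have hq : (0 : ℝ) ≤ q := by positivity
  have h4 := mul_le_mul_of_nonneg_left h3 (by positivity : (0 : ℝ) ≤ q + 1)
  linarith

/-- Hypercontractive moment bound for the fourth chaos, in terms of the (constant) fourth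
derivative. -/
theorem chaos_four_moment_le (hv : ∀ i, 0 ≤ v i) {F : MvPolynomial ι ℝ} (hF : F ∈ chaos v 4)
    {D : ι → ι → ι → ι → ℝ}
    (hD : ∀ i j k l, pderiv i (pderiv j (pderiv k (pderiv l F))) = C (D i j k l)) (q : ℕ) :
    E (F ^ (2 * (q + 1))) ≤
      ((2 * q + 1) ^ 4 / 24 * ∑ i, ∑ j, ∑ k, ∑ l, v i * v j * v k * v l * D i j k l ^ 2)
        ^ (q + 1) := by
  have s1 := hE.chaos_moment_le hv (J := Unit) (w := fun _ => 1) (fun _ => zero_le_one)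
    (F := fun _ => F) (n := 4) (by norm_num) (fun _ => hF) q
  have s2 := hE.chaos_moment_le hv (J := ι) (w := fun l => v l) hv
    (F := fun l => pderiv l F) (n := 3) (by norm_num) (fun l => pderiv_mem_chaos hF l) q
  have s3 := hE.chaos_moment_le hv (J := ι × ι) (w := fun a => v a.1 * v a.2)
    (fun a => mul_nonneg (hv _) (hv _))
    (F := fun a => pderiv a.1 (pderiv a.2 F)) (n := 2) (by norm_num)
    (fun a => pderiv_mem_chaos (pderiv_mem_chaos hF _) _) q
  have s4 := hE.chaos_moment_le hv (J := ι × ι × ι) (w := fun a => v a.1 * (v a.2.1 * v a.2.2))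
    (fun a => mul_nonneg (hv _) (mul_nonneg (hv _) (hv _)))
    (F := fun a => pderiv a.1 (pderiv a.2.1 (pderiv a.2.2 F))) (n := 1) (by norm_num)
    (fun a => pderiv_mem_chaos (pderiv_mem_chaos (pderiv_mem_chaos hF _) _) _) q
  simp only [Fintype.sum_prod_type, Finset.univ_unique, Finset.sum_singleton, C_1, one_mul,
    mul_one, hD] at s1 s2 s3 s4
  have e4 : E ((∑ i, ∑ j, ∑ k, ∑ l, C (v i * (v j * (v k * v l))) * (C (D i j k l)) ^ 2) ^ (q + 1))
      = (∑ i, ∑ j, ∑ k, ∑ l, v i * v j * v k * v l * D i j k l ^ 2) ^ (q + 1) := by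
    have : (∑ i, ∑ j, ∑ k, ∑ l, C (v i * (v j * (v k * v l))) * (C (D i j k l)) ^ 2) ^ (q + 1)
        = (((∑ i, ∑ j, ∑ k, ∑ l, v i * v j * v k * v l * D i j k l ^ 2) ^ (q + 1)) •
          (1 : MvPolynomial ι ℝ)) := by
      rw [smul_eq_C_mul, mul_one, map_pow]
      simp only [map_sum, map_mul, map_pow, mul_assoc]
    rw [this, map_smul, hE.map_one, smul_eq_mul, mul_one]
  rw [e4] at s4
  rw [← pow_mul] at s1
  set K := ∑ i, ∑ j, ∑ k, ∑ l, v i * v j * v k * v l * D i j k l ^ 2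
  have hpos : ∀ m : ℕ, (0 : ℝ) ≤ ((2 * q + 1) / (m : ℝ)) ^ (q + 1) := fun m => by positivity
  refine s1.trans ?_
  refine (mul_le_mul_of_nonneg_left s2 (hpos 4)).trans ?_
  refine (mul_le_mul_of_nonneg_left (mul_le_mul_of_nonneg_left s3 (hpos 3)) (hpos 4)).trans ?_
  refine (mul_le_mul_of_nonneg_left (mul_le_mul_of_nonneg_left
    (mul_le_mul_of_nonneg_left s4 (hpos 2)) (hpos 3)) (hpos 4)).trans (le_of_eq ?_)
  simp only [← mul_pow]
  congr 1
  push_cast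
  ring

end IsGaussianExpectation

end Chaos

/-! ### Fourier modes on the torus -/

/-- The phase `(2π/L) k·p`. -/
def phase (L : ℝ) (k : ℤ × ℤ) (p : ℝ × ℝ) : ℝ := (2 * Real.pi / L) * (k.1 * p.1 + k.2 * p.2)

/-- The real `L²`-orthonormal Fourier basis dual to the real coordinates of `State N`: the
constant, cosines for the frequencies in the positive half, and sines for the others. -/
def mode (L : ℝ) (k : ℤ × ℤ) (p : ℝ × ℝ) : ℝ :=
  if k = 0 then 1 / L
  else if IsPos k then Real.sqrt 2 / L * Real.cos (phase L k p)
  else Real.sqrt 2 / L * Real.sin (phase L k p)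

theorem phase_neg (L : ℝ) (k : ℤ × ℤ) (p : ℝ × ℝ) : phase L (-k) p = -phase L k p := by
  simp [phase]; ring

theorem phase_zero (L : ℝ) (p : ℝ × ℝ) : phase L 0 p = 0 := by simp [phase]

theorem phase_add (L : ℝ) (k l : ℤ × ℤ) (p : ℝ × ℝ) :
    phase L (k + l) p = phase L k p + phase L l p := by
  simp [phase]; ring

@[fun_prop]
theorem continuous_phase (L : ℝ) (k : ℤ × ℤ) : Continuous (phase L k) := by
  unfold phase; fun_prop

@[fun_prop]
theorem continuous_mode (L : ℝ) (k : ℤ × ℤ) : Continuous (mode L k) := by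
  unfold mode
  split_ifs <;> fun_prop

theorem isPos_neg {k : ℤ × ℤ} (hk : k ≠ 0) : IsPos (-k) ↔ ¬ IsPos k := by
  obtain ⟨a, b⟩ := k
  simp only [ne_eq, Prod.mk_eq_zero] at hk
  simp only [IsPos, Prod.fst_neg, Prod.snd_neg]
  omega

/-- The involution `k ↦ -k` of the frequencies. -/
def oppEquiv (N : ℕ) : Freq N ≃ Freq N := ⟨Freq.opp, Freq.opp, Freq.opp_opp, Freq.opp_opp⟩

theorem basisFun_eq (L : ℝ) (k : ℤ × ℤ) (p : ℝ × ℝ) :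
    basisFun L k p = (1 / L : ℂ) * Complex.exp (Complex.I * (phase L k p : ℝ)) := rfl

theorem basisFun_re_im (L : ℝ) (k : ℤ × ℤ) (p : ℝ × ℝ) :
    basisFun L k p = ((1 / L * Real.cos (phase L k p) : ℝ) : ℂ)
      + ((1 / L * Real.sin (phase L k p) : ℝ) : ℂ) * Complex.I := by
  rw [basisFun_eq, mul_comm Complex.I, Complex.exp_mul_I]
  push_cast; ring

theorem field_eq_sum_mode (L : ℝ) {N : ℕ} (x : State N) (p : ℝ × ℝ) :
    field L x p = ∑ k : Freq N, x k * mode L k.1 p := by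
  have h2 : Real.sqrt 2 * Real.sqrt 2 = 2 := Real.mul_self_sqrt (by norm_num)
  let f : Freq N → ℝ := fun k => if k.1 = 0 then 1 / L
    else if IsPos k.1 then 1 / (Real.sqrt 2 * L) * Real.cos (phase L k.1 p)
    else 1 / (Real.sqrt 2 * L) * Real.sin (phase L k.1 p)
  let g : Freq N → ℝ := fun k => if k.1 = 0 then 0
    else if IsPos k.1 then -(1 / (Real.sqrt 2 * L) * Real.sin (phase L k.1 p))
    else 1 / (Real.sqrt 2 * L) * Real.cos (phase L k.1 p)
  have h1 : field L x p = ∑ k : Freq N, (x k * f k + x k.opp * g k) := by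
    unfold field
    rw [Complex.re_sum]
    refine Finset.sum_congr rfl fun k _ => ?_
    have hdiv : ∀ z : ℂ, z / (Real.sqrt 2 : ℂ) = ((1 / Real.sqrt 2 : ℝ) : ℂ) * z := by
      intro z; push_cast; field_simp
    have h0' : k.1 = 0 → Real.cos (phase L k.1 p) = 1 := fun h0 => by simp [h0, phase_zero]
    simp only [f, g, coef, hdiv, basisFun_re_im]
    generalize Real.cos (phase L k.1 p) = c at *
    generalize Real.sin (phase L k.1 p) = d
    split_ifs with h0 hp
    · simp [h0' h0]
    · simp only [Complex.mul_re, Complex.mul_im, Complex.add_re, Complex.add_im, Complex.ofReal_re,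
        Complex.ofReal_im, Complex.I_re, Complex.I_im]
      ring
    · simp only [Complex.mul_re, Complex.mul_im, Complex.add_re, Complex.add_im, Complex.ofReal_re,
        Complex.ofReal_im, Complex.I_re, Complex.I_im, Complex.sub_re, Complex.sub_im]
      ring
  have h3 : ∑ k : Freq N, x k.opp * g k = ∑ k : Freq N, x k * g k.opp :=
    Fintype.sum_equiv (oppEquiv N) _ _ (fun k => by simp [oppEquiv, Freq.opp_opp])
  rw [h1, Finset.sum_add_distrib, h3, ← Finset.sum_add_distrib]
  refine Finset.sum_congr rfl fun k _ => ?_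
  rw [← mul_add]
  congr 1
  have hs : 1 / (Real.sqrt 2 * L) + 1 / (Real.sqrt 2 * L) = Real.sqrt 2 / L := by
    rcases eq_or_ne L 0 with rfl | hL
    · simp
    · field_simp; linarith
  simp only [f, g, mode, Freq.opp, neg_eq_zero]
  by_cases h0 : k.1 = 0
  · simp [h0]
  · by_cases hp : IsPos k.1
    · simp only [h0, hp, if_false, if_true, (isPos_neg h0), not_true, phase_neg, Real.cos_neg]
      rw [← add_mul, hs]
    · simp only [h0, hp, if_false, if_true, (isPos_neg h0), not_false_eq_true, phase_neg,
        Real.sin_neg, mul_neg, neg_neg]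
      rw [← add_mul, hs]

/-- A real mode is a combination, with coefficients in the unit disc, of the two exponentials
of phases `± phase L k`. -/
theorem exists_mode_eq (L : ℝ) (k : ℤ × ℤ) : ∃ α : ℤˣ → ℂ, (∀ s, ‖α s‖ ≤ 1) ∧
    ∀ p, (mode L k p : ℂ) =
      ∑ s : ℤˣ, (1 / L : ℂ) * α s * Complex.exp (Complex.I * (phase L ((s : ℤ) • k) p : ℝ)) := by
  have hn : ‖((Real.sqrt 2 / 2 : ℝ) : ℂ)‖ ≤ 1 := by
    rw [Complex.norm_real, Real.norm_of_nonneg (by positivity)]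
    have : Real.sqrt 2 ≤ 2 := by rw [Real.sqrt_le_left (by norm_num)]; norm_num
    linarith
  have hsum : ∀ (h : ℤˣ → ℂ), ∑ s : ℤˣ, h s = h 1 + h (-1) := by
    intro h
    rw [show (Finset.univ : Finset ℤˣ) = {1, -1} from rfl, Finset.sum_pair (by decide)]
  by_cases h0 : k = 0
  · refine ⟨fun s => if s = 1 then 1 else 0, fun s => by beta_reduce; split_ifs <;> simp,
      fun p => ?_⟩
    rw [hsum]
    simp [mode, h0, phase_zero]
  by_cases hp : IsPos k
  · refine ⟨fun _ => ((Real.sqrt 2 / 2 : ℝ) : ℂ), fun _ => hn, fun p => ?_⟩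
    rw [hsum]
    simp only [mode, h0, hp, if_true, if_false, Units.val_one, one_smul, Units.val_neg, neg_smul,
      phase_neg]
    push_cast
    rw [Complex.cos]
    ring_nf
  · refine ⟨fun s => if s = 1 then -Complex.I * ((Real.sqrt 2 / 2 : ℝ) : ℂ)
      else Complex.I * ((Real.sqrt 2 / 2 : ℝ) : ℂ), fun s => ?_, fun p => ?_⟩
    · beta_reduce
      split_ifs <;> simpa using hn
    · rw [hsum]
      simp only [mode, h0, hp, if_true, if_false, Units.val_one, one_smul, Units.val_neg, neg_smul,
        phase_neg, show (-1 : ℤˣ) ≠ 1 by decide]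
      push_cast
      rw [Complex.sin]
      ring_nf

theorem sum_freqs_symm (M : ℕ) (h : ℤ × ℤ → ℝ) :
    ∑ k ∈ freqs M, h k = ∑ k ∈ freqs M, h (-k) :=
  Finset.sum_bij' (fun k _ => -k) (fun k _ => -k) (fun _ h => neg_mem_freqs h)
    (fun _ h => neg_mem_freqs h) (by simp) (by simp) (by simp)

theorem lam_neg (L : ℝ) (k : ℤ × ℤ) : lam L (-k) = lam L k := by simp [lam]

/-- The variance of the Gaussian free field is constant in space: cosines and sines with the
same frequency pair up. -/
theorem sum_mode_sq (L : ℝ) (M : ℕ) (p : ℝ × ℝ) :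
    ∑ k ∈ freqs M, 1 / |lam L k| * mode L k p ^ 2 = renormConst L M := by
  have h : ∀ k : ℤ × ℤ, mode L k p ^ 2 + mode L (-k) p ^ 2 = 2 * (1 / L ^ 2) := by
    intro k
    have h2 : Real.sqrt 2 ^ 2 = 2 := Real.sq_sqrt (by norm_num)
    have hcs := Real.sin_sq_add_cos_sq (phase L k p)
    by_cases h0 : k = 0
    · simp [mode, h0]; ring
    by_cases hp : IsPos k <;>
    · simp only [mode, h0, hp, neg_eq_zero, isPos_neg h0, if_true, if_false, phase_neg, not_true,
        not_false_eq_true, Real.cos_neg, Real.sin_neg]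
      simp only [div_eq_mul_inv, mul_pow, neg_sq, h2, inv_pow, one_mul]
      linear_combination (2 * (L ^ 2)⁻¹) * hcs
  have h' : 2 * ∑ k ∈ freqs M, 1 / |lam L k| * mode L k p ^ 2
      = 2 * ∑ k ∈ freqs M, 1 / |lam L k| * (1 / L ^ 2) := by
    rw [two_mul]
    conv_lhs => arg 2; rw [sum_freqs_symm]
    rw [← Finset.sum_add_distrib, Finset.mul_sum]
    refine Finset.sum_congr rfl fun k _ => ?_
    rw [lam_neg, ← mul_add, h]; ring
  rw [renormConst, Finset.mul_sum]
  have := mul_left_cancel₀ two_ne_zero h'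
  rw [this]
  exact Finset.sum_congr rfl fun k _ => mul_comm _ _

/-! ### Integration over the torus -/

/-- Lebesgue measure on the fundamental domain `[0,L]²`. -/
def torusMeasure (L : ℝ) : Measure (ℝ × ℝ) :=
  (volume : Measure (ℝ × ℝ)).restrict (Set.Icc (0 : ℝ) L ×ˢ Set.Icc (0 : ℝ) L)

theorem torusIntegral_eq (L : ℝ) (f : ℝ × ℝ → ℝ) :
    torusIntegral L f = ∫ p, f p ∂(torusMeasure L) := rfl

instance (L : ℝ) : IsFiniteMeasure (torusMeasure L) :=
  ⟨by
    rw [torusMeasure, Measure.restrict_apply_univ]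
    exact (isCompact_Icc.prod isCompact_Icc).measure_lt_top⟩

theorem _root_.Continuous.integrable_torusMeasure {E : Type*} [NormedAddCommGroup E]
    {f : ℝ × ℝ → E} (hf : Continuous f) (L : ℝ) : Integrable f (torusMeasure L) :=
  hf.continuousOn.integrableOn_compact (isCompact_Icc.prod isCompact_Icc)

theorem torusMeasure_real_univ {L : ℝ} (hL : 0 ≤ L) : (torusMeasure L).real Set.univ = L ^ 2 := by
  rw [torusMeasure, measureReal_restrict_apply_univ, Measure.volume_eq_prod, measureReal_prod_prod]
  simp [hL]; ring

theorem integral_exp_period {L : ℝ} (hL : 0 < L) (m : ℤ) :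
    ∫ t in Set.Icc (0 : ℝ) L, Complex.exp (Complex.I * (((2 * Real.pi / L) * (m * t) : ℝ) : ℂ))
      = if m = 0 then (L : ℂ) else 0 := by
  rw [integral_Icc_eq_integral_Ioc, ← intervalIntegral.integral_of_le hL.le]
  split_ifs with hm
  · simp [hm]
  · have hc : (2 * Real.pi * m / L * Complex.I : ℂ) ≠ 0 := by
      have : (L : ℂ) ≠ 0 := by exact_mod_cast hL.ne'
      have : (m : ℂ) ≠ 0 := by exact_mod_cast hm
      have : (Real.pi : ℂ) ≠ 0 := by exact_mod_cast Real.pi_ne_zero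
      simp [*]
    have := integral_exp_mul_complex (a := 0) (b := L) hc
    have he : ∀ t : ℝ, Complex.exp (Complex.I * (((2 * Real.pi / L) * (m * t) : ℝ) : ℂ))
        = Complex.exp (2 * Real.pi * m / L * Complex.I * t) := by
      intro t; congr 1; push_cast; ring
    simp only [he]
    rw [this]
    have hL' : (L : ℂ) ≠ 0 := by exact_mod_cast hL.ne'
    have e : (2 * Real.pi * m / L * Complex.I * (L : ℂ)) = m * (2 * Real.pi * Complex.I) := by
      field_simp
    rw [e, Complex.exp_int_mul_two_pi_mul_I]
    simp

theorem integral_exp_phase {L : ℝ} (hL : 0 < L) (m : ℤ × ℤ) :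
    ∫ p, Complex.exp (Complex.I * (phase L m p : ℝ)) ∂(torusMeasure L)
      = if m = 0 then (L : ℂ) ^ 2 else 0 := by
  have he : ∀ p : ℝ × ℝ, Complex.exp (Complex.I * (phase L m p : ℝ))
      = Complex.exp (Complex.I * (((2 * Real.pi / L) * (m.1 * p.1) : ℝ) : ℂ))
        * Complex.exp (Complex.I * (((2 * Real.pi / L) * (m.2 * p.2) : ℝ) : ℂ)) := by
    intro p
    rw [← Complex.exp_add]; congr 1; simp only [phase]; push_cast; ring
  simp only [he]
  rw [torusMeasure, Measure.volume_eq_prod, setIntegral_prod_mul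
    (f := fun t : ℝ => Complex.exp (Complex.I * (((2 * Real.pi / L) * (m.1 * t) : ℝ) : ℂ)))
    (g := fun t : ℝ => Complex.exp (Complex.I * (((2 * Real.pi / L) * (m.2 * t) : ℝ) : ℂ))),
    integral_exp_period hL, integral_exp_period hL]
  obtain ⟨a, b⟩ := m
  by_cases ha : a = 0 <;> by_cases hb : b = 0 <;> simp [ha, hb, pow_two]

@[fun_prop]
theorem continuous_basisFun (L : ℝ) (k : ℤ × ℤ) : Continuous (basisFun L k) := by
  unfold basisFun; fun_prop

theorem integral_basisFun_mul_conj {L : ℝ} (hL : 0 < L) (k l : ℤ × ℤ) :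
    ∫ p, basisFun L k p * (starRingEnd ℂ) (basisFun L l p) ∂(torusMeasure L)
      = if k = l then 1 else 0 := by
  have hL' : (L : ℂ) ≠ 0 := by exact_mod_cast hL.ne'
  have he : ∀ p, basisFun L k p * (starRingEnd ℂ) (basisFun L l p)
      = (1 / L ^ 2 : ℂ) * Complex.exp (Complex.I * (phase L (k - l) p : ℝ)) := by
    intro p
    rw [sub_eq_add_neg, phase_add, phase_neg]
    simp only [basisFun_eq, map_mul, map_div₀, map_one, Complex.conj_ofReal,
      ← Complex.exp_conj, Complex.conj_I]
    push_cast
    rw [mul_add, Complex.exp_add, mul_neg, neg_mul]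
    ring
  simp only [he]
  rw [integral_const_mul, integral_exp_phase hL]
  simp only [sub_eq_zero]
  split_ifs
  · field_simp
  · simp

/-- Parseval's identity for trigonometric polynomials. -/
theorem integral_normSq_sum {L : ℝ} (hL : 0 < L) {N : ℕ} (c : Freq N → ℂ) :
    torusIntegral L (fun p => ‖∑ k, c k * basisFun L k.1 p‖ ^ 2) = ∑ k, ‖c k‖ ^ 2 := by
  have h : ((torusIntegral L (fun p => ‖∑ k, c k * basisFun L k.1 p‖ ^ 2) : ℝ) : ℂ)
      = ((∑ k, ‖c k‖ ^ 2 : ℝ) : ℂ) := by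
    rw [torusIntegral_eq, ← integral_complex_ofReal]
    have e : ∀ p, ((‖∑ k, c k * basisFun L k.1 p‖ ^ 2 : ℝ) : ℂ)
        = ∑ k, ∑ l, (c k * (starRingEnd ℂ) (c l)) *
          (basisFun L k.1 p * (starRingEnd ℂ) (basisFun L l.1 p)) := by
      intro p
      rw [Complex.ofReal_pow, ← Complex.mul_conj', map_sum, Finset.sum_mul_sum]
      refine Finset.sum_congr rfl fun k _ => Finset.sum_congr rfl fun l _ => ?_
      rw [map_mul]; ring
    simp only [e]
    rw [integral_finsetSum _ fun k _ => Continuous.integrable_torusMeasure (by fun_prop) L]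
    push_cast
    refine Finset.sum_congr rfl fun k _ => ?_
    rw [integral_finsetSum _ fun l _ => Continuous.integrable_torusMeasure (by fun_prop) L]
    simp only [integral_const_mul, integral_basisFun_mul_conj hL, mul_ite, mul_one, mul_zero]
    rw [Finset.sum_eq_single k (fun l _ hlk => if_neg fun h => hlk (Subtype.ext h).symm)
      (fun h => absurd (Finset.mem_univ k) h)]
    rw [if_pos rfl, Complex.mul_conj']
  exact_mod_cast h

theorem four_sum_mul {ι R : Type*} [Fintype ι] [CommSemiring R] (f g h k : ι → R) :
    (∑ a, f a) * (∑ b, g b) * (∑ c, h c) * (∑ d, k d)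
      = ∑ a, ∑ b, ∑ c, ∑ d, f a * (g b * (h c * k d)) := by
  simp only [← Finset.mul_sum, ← Finset.sum_mul]
  ring

/-- Four modes only interact when some signed sum of their frequencies vanishes. -/
theorem sq_integral_four_modes_le {L : ℝ} (hL : 0 < L) (i j k l : ℤ × ℤ) :
    (torusIntegral L fun p => mode L i p * mode L j p * mode L k p * mode L l p) ^ 2 ≤
      16 / L ^ 4 * ∑ a : ℤˣ, ∑ b : ℤˣ, ∑ c : ℤˣ, ∑ d : ℤˣ,
        if (a : ℤ) • i + (b : ℤ) • j + (c : ℤ) • k + (d : ℤ) • l = 0 then 1 else 0 := by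
  obtain ⟨α, hα, ei⟩ := exists_mode_eq L i
  obtain ⟨β, hβ, ej⟩ := exists_mode_eq L j
  obtain ⟨γ, hγ, ek⟩ := exists_mode_eq L k
  obtain ⟨δ, hδ, el⟩ := exists_mode_eq L l
  set R : ℝ := ∑ a : ℤˣ, ∑ b : ℤˣ, ∑ c : ℤˣ, ∑ d : ℤˣ,
        if (a : ℤ) • i + (b : ℤ) • j + (c : ℤ) • k + (d : ℤ) • l = 0 then 1 else 0 with hR
  set T : ℝ := torusIntegral L fun p => mode L i p * mode L j p * mode L k p * mode L l p with hT
  have hTc : (T : ℂ) = ∑ a : ℤˣ, ∑ b : ℤˣ, ∑ c : ℤˣ, ∑ d : ℤˣ,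
      (1 / L ^ 4 : ℂ) * (α a * β b * γ c * δ d) *
        (if (a : ℤ) • i + (b : ℤ) • j + (c : ℤ) • k + (d : ℤ) • l = 0 then (L : ℂ) ^ 2 else 0) := by
    rw [hT, torusIntegral_eq, ← integral_complex_ofReal]
    have e : ∀ p, ((mode L i p * mode L j p * mode L k p * mode L l p : ℝ) : ℂ)
        = ∑ a : ℤˣ, ∑ b : ℤˣ, ∑ c : ℤˣ, ∑ d : ℤˣ,
          ((1 / L ^ 4 : ℂ) * (α a * β b * γ c * δ d)) * Complex.exp (Complex.I *
            (phase L ((a : ℤ) • i + (b : ℤ) • j + (c : ℤ) • k + (d : ℤ) • l) p : ℝ)) := by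
      intro p
      push_cast
      rw [ei, ej, ek, el]
      rw [four_sum_mul]
      refine Finset.sum_congr rfl fun a _ => Finset.sum_congr rfl fun b _ =>
        Finset.sum_congr rfl fun c _ => Finset.sum_congr rfl fun d _ => ?_
      simp only [phase_add]
      push_cast
      simp only [mul_add, Complex.exp_add]
      ring
    simp only [e]
    rw [integral_finsetSum _ fun a _ => Continuous.integrable_torusMeasure (by fun_prop) L]
    refine Finset.sum_congr rfl fun a _ => ?_
    rw [integral_finsetSum _ fun b _ => Continuous.integrable_torusMeasure (by fun_prop) L]
    refine Finset.sum_congr rfl fun b _ => ?_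
    rw [integral_finsetSum _ fun c _ => Continuous.integrable_torusMeasure (by fun_prop) L]
    refine Finset.sum_congr rfl fun c _ => ?_
    rw [integral_finsetSum _ fun d _ => Continuous.integrable_torusMeasure (by fun_prop) L]
    refine Finset.sum_congr rfl fun d _ => ?_
    rw [integral_const_mul, integral_exp_phase hL]
  have hle : |T| ≤ 1 / L ^ 2 * R := by
    rw [← Real.norm_eq_abs, ← Complex.norm_real, hTc, hR]
    simp only [Finset.mul_sum]
    refine (norm_sum_le _ _).trans (Finset.sum_le_sum fun a _ => ?_)
    refine (norm_sum_le _ _).trans (Finset.sum_le_sum fun b _ => ?_)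
    refine (norm_sum_le _ _).trans (Finset.sum_le_sum fun c _ => ?_)
    refine (norm_sum_le _ _).trans (Finset.sum_le_sum fun d _ => ?_)
    have hc : ‖α a * β b * γ c * δ d‖ ≤ 1 := by
      simp only [norm_mul]
      have h1 := mul_le_one₀ (hα a) (norm_nonneg _) (hβ b)
      have h2 := mul_le_one₀ h1 (norm_nonneg _) (hγ c)
      exact mul_le_one₀ h2 (norm_nonneg _) (hδ d)
    rw [norm_mul, norm_mul]
    split_ifs
    · have hL4 : ‖(1 / L ^ 4 : ℂ)‖ = 1 / L ^ 4 := by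
        rw [norm_div, norm_one, norm_pow, Complex.norm_real, Real.norm_of_nonneg hL.le]
      have hL2 : ‖(L ^ 2 : ℂ)‖ = L ^ 2 := by
        rw [norm_pow, Complex.norm_real, Real.norm_of_nonneg hL.le]
      rw [hL4, hL2]
      calc _ ≤ 1 / L ^ 4 * 1 * L ^ 2 := by gcongr
        _ = _ := by field_simp
    · simp
  have hR16 : R ≤ 16 := by
    have : R ≤ ∑ a : ℤˣ, ∑ b : ℤˣ, ∑ c : ℤˣ, ∑ d : ℤˣ, (1 : ℝ) := by
      rw [hR]
      gcongr
      split_ifs <;> norm_num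
    refine this.trans (le_of_eq ?_)
    simp only [Finset.sum_const, Finset.card_univ, Fintype.card_units_int, nsmul_eq_mul]
    norm_num
  have hR0 : 0 ≤ R := by
    rw [hR]
    exact Finset.sum_nonneg fun a _ => Finset.sum_nonneg fun b _ => Finset.sum_nonneg fun c _ =>
        Finset.sum_nonneg fun d _ => by split_ifs <;> norm_num
  clear_value R T
  calc T ^ 2 = |T| ^ 2 := (sq_abs T).symm
    _ ≤ (1 / L ^ 2 * R) ^ 2 := by gcongr
    _ = 1 / L ^ 4 * (R * R) := by ring
    _ ≤ 1 / L ^ 4 * (16 * R) := by gcongr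
    _ = 16 / L ^ 4 * R := by ring

/-! ### The potential in Fourier coordinates -/

/-- The zero frequency. -/
def zeroFreq (N : ℕ) : Freq N := ⟨0, by simp [freqs]⟩

theorem lam_zero (L : ℝ) : lam L 0 = -1 := by simp [lam]

theorem lam_pos {L : ℝ} (hL0 : 0 < L) (hL : L < 2 * Real.pi) {k : ℤ × ℤ} (hk : k ≠ 0) :
    0 < lam L k := by
  have h1 : 1 < 2 * Real.pi / L := by rwa [lt_div_iff₀ hL0, one_mul]
  have h2 : (1 : ℝ) ≤ (k.1 : ℝ) ^ 2 + (k.2 : ℝ) ^ 2 := by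
    have : (1 : ℤ) ≤ k.1 ^ 2 + k.2 ^ 2 := by
      obtain ⟨a, b⟩ := k
      simp only [ne_eq, Prod.mk_eq_zero, not_and_or] at hk
      rcases hk with hk | hk
      · have := pow_pos (abs_pos.2 hk) 2
        rw [sq_abs] at this
        have := sq_nonneg b
        simp only; omega
      · have := pow_pos (abs_pos.2 hk) 2
        rw [sq_abs] at this
        have := sq_nonneg a
        simp only; omega
    exact_mod_cast this
  have h3 : 1 < (2 * Real.pi / L) ^ 2 := by nlinarith
  unfold lam
  nlinarith

theorem abs_lam_pos {L : ℝ} (hL0 : 0 < L) (hL : L < 2 * Real.pi) (k : ℤ × ℤ) :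
    0 < |lam L k| := by
  rcases eq_or_ne k 0 with rfl | hk
  · simp [lam_zero]
  · exact abs_pos.2 (lam_pos hL0 hL hk).ne'

theorem coef_smul {N : ℕ} (r : ℝ) (x : State N) (k : Freq N) :
    coef (r • x) k = r * coef x k := by
  unfold coef
  split_ifs <;> simp <;> ring

theorem norm_coef_zeroFreq {N : ℕ} (x : State N) :
    ‖coef x (zeroFreq N)‖ ^ 2 = x (zeroFreq N) ^ 2 := by
  simp [coef, zeroFreq]

theorem field_smul (L r : ℝ) {N : ℕ} (x : State N) (p : ℝ × ℝ) :
    field L (r • x) p = r * field L x p := by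
  simp only [field_eq_sum_mode, Finset.mul_sum]
  exact Finset.sum_congr rfl fun k _ => by simp; ring

@[fun_prop]
theorem continuous_field (L : ℝ) {N : ℕ} (x : State N) : Continuous (field L x) := by
  have : field L x = fun p => ∑ k : Freq N, x k * mode L k.1 p := funext (field_eq_sum_mode L x)
  rw [this]; fun_prop

theorem integral_field_sq {L : ℝ} (hL : 0 < L) {N : ℕ} (x : State N) :
    torusIntegral L (fun p => field L x p ^ 2) = ∑ k, ‖coef x k‖ ^ 2 := by
  rw [← integral_normSq_sum hL]
  congr 1
  ext p
  rw [← field_eq, Complex.norm_real, Real.norm_eq_abs, sq_abs]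

theorem mean_field {L : ℝ} (hL : 0 < L) {N : ℕ} (x : State N) :
    mean L (field L x) = x (zeroFreq N) / L := by
  have h : ((torusIntegral L (field L x) : ℝ) : ℂ) = L * x (zeroFreq N) := by
    rw [torusIntegral_eq, ← integral_complex_ofReal]
    simp only [field_eq]
    rw [integral_finsetSum _ fun k _ => Continuous.integrable_torusMeasure (by fun_prop) L]
    simp only [integral_const_mul, basisFun_eq, integral_exp_phase hL]
    rw [Finset.sum_eq_single (zeroFreq N)]
    · have hL' : (L : ℂ) ≠ 0 := by exact_mod_cast hL.ne'
      simp only [zeroFreq, coef, if_true]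
      field_simp
    · intro k _ hk
      have : k.1 ≠ 0 := fun h => hk (Subtype.ext h)
      simp [this]
    · simp
  have h' : torusIntegral L (field L x) = L * x (zeroFreq N) := by exact_mod_cast h
  rw [mean, h']
  field_simp

theorem ofReal_deriv_eq_sum {ι : Type*} [Fintype ι] (f : ℝ → ℝ) (c : ι → ℂ) (u : ι → ℝ → ℂ)
    (u' : ι → ℂ) (t : ℝ) (hf : ∀ t, (f t : ℂ) = ∑ k, c k * u k t)
    (hu : ∀ k, HasDerivAt (u k) (u' k) t) : ((deriv f t : ℝ) : ℂ) = ∑ k, c k * u' k := by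
  have h1 : HasDerivAt (fun t => (f t : ℂ)) (∑ k, c k * u' k) t := by
    simp only [hf]
    exact HasDerivAt.fun_sum fun k _ => (hu k).const_mul (c k)
  have h2 : HasDerivAt f (∑ k, c k * u' k).re t := by
    have := Complex.reCLM.hasFDerivAt.comp_hasDerivAt t h1
    exact this
  rw [h2.deriv]
  exact h2.ofReal_comp.unique h1

theorem hasDerivAt_basisFun_fst (L : ℝ) (k : ℤ × ℤ) (p : ℝ × ℝ) :
    HasDerivAt (fun t : ℝ => basisFun L k (t, p.2))
      ((Complex.I * ((2 * Real.pi / L * k.1 : ℝ) : ℂ)) * basisFun L k p) p.1 := by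
  have h : HasDerivAt (fun t : ℝ => (2 * Real.pi / L) * (k.1 * t + k.2 * p.2))
      (2 * Real.pi / L * (k.1 * 1)) p.1 :=
    (((hasDerivAt_id p.1).const_mul (k.1 : ℝ)).add_const _).const_mul _
  have h2 := ((h.ofReal_comp.const_mul Complex.I).cexp).const_mul (1 / L : ℂ)
  refine h2.congr_deriv ?_
  simp only [basisFun, mul_one]
  ring

theorem hasDerivAt_basisFun_snd (L : ℝ) (k : ℤ × ℤ) (p : ℝ × ℝ) :
    HasDerivAt (fun t : ℝ => basisFun L k (p.1, t))
      ((Complex.I * ((2 * Real.pi / L * k.2 : ℝ) : ℂ)) * basisFun L k p) p.2 := by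
  have h : HasDerivAt (fun t : ℝ => (2 * Real.pi / L) * (k.1 * p.1 + k.2 * t))
      (2 * Real.pi / L * (k.2 * 1)) p.2 :=
    (((hasDerivAt_id p.2).const_mul (k.2 : ℝ)).const_add _).const_mul _
  have h2 := ((h.ofReal_comp.const_mul Complex.I).cexp).const_mul (1 / L : ℂ)
  refine h2.congr_deriv ?_
  simp only [basisFun, mul_one]
  ring

theorem gradSq_field (L : ℝ) {N : ℕ} (x : State N) (p : ℝ × ℝ) :
    gradSq (field L x) p
      = ‖∑ k : Freq N, (coef x k * (Complex.I * ((2 * Real.pi / L * k.1.1 : ℝ) : ℂ)))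
          * basisFun L k.1 p‖ ^ 2
        + ‖∑ k : Freq N, (coef x k * (Complex.I * ((2 * Real.pi / L * k.1.2 : ℝ) : ℂ)))
          * basisFun L k.1 p‖ ^ 2 := by
  have h1 := ofReal_deriv_eq_sum (fun t => field L x (t, p.2)) (fun k : Freq N => coef x k)
    (fun k t => basisFun L k.1 (t, p.2)) _ p.1 (fun t => field_eq L x (t, p.2))
    (fun k => hasDerivAt_basisFun_fst L k.1 p)
  have h2 := ofReal_deriv_eq_sum (fun t => field L x (p.1, t)) (fun k : Freq N => coef x k)
    (fun k t => basisFun L k.1 (p.1, t)) _ p.2 (fun t => field_eq L x (p.1, t))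
    (fun k => hasDerivAt_basisFun_snd L k.1 p)
  simp only [mul_assoc] at h1 h2 ⊢
  rw [← h1, ← h2, gradSq, Complex.norm_real, Complex.norm_real, Real.norm_eq_abs,
    Real.norm_eq_abs, sq_abs, sq_abs]

/-- The quadratic part of the potential is diagonal in Fourier coordinates. -/
theorem integral_gradSq_sub_sq {L : ℝ} (hL : 0 < L) {N : ℕ} (x : State N) :
    torusIntegral L (fun p => gradSq (field L x) p - field L x p ^ 2)
      = ∑ k : Freq N, lam L k.1 * ‖coef x k‖ ^ 2 := by
  simp only [gradSq_field]
  rw [torusIntegral_eq, integral_sub (Continuous.integrable_torusMeasure (by fun_prop) L)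
    (Continuous.integrable_torusMeasure (by fun_prop) L),
    integral_add (Continuous.integrable_torusMeasure (by fun_prop) L)
    (Continuous.integrable_torusMeasure (by fun_prop) L), ← torusIntegral_eq, ← torusIntegral_eq,
    ← torusIntegral_eq, integral_normSq_sum hL, integral_normSq_sum hL, integral_field_sq hL,
    ← Finset.sum_add_distrib, ← Finset.sum_sub_distrib]
  refine Finset.sum_congr rfl fun k _ => ?_
  simp only [norm_mul, Complex.norm_I, Complex.norm_real, Real.norm_eq_abs, one_mul, mul_pow,
    sq_abs, lam]
  ring

theorem quadForm_eq_sum_sq (L : ℝ) {N : ℕ} (y : State N) :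
    quadForm L y = 1 / 2 * ∑ k : Freq N, |lam L k.1| * y k ^ 2 := by
  have key : ∀ k : Freq N, ‖coef y k‖ ^ 2 = (y k ^ 2 + y k.opp ^ 2) / 2 := by
    intro k
    have hs : Real.sqrt 2 * Real.sqrt 2 = 2 := Real.mul_self_sqrt (by norm_num)
    rw [← Complex.normSq_eq_norm_sq]
    unfold coef
    split_ifs with h0 hp
    · have h1 : k.opp = k := by
        apply Subtype.ext
        simp only [Freq.opp]
        rw [h0]; simp
      rw [h1, Complex.normSq_ofReal]; ring
    · rw [Complex.normSq_div, Complex.normSq_ofReal, hs, Complex.normSq_add_mul_I]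
    · rw [Complex.normSq_div, Complex.normSq_ofReal, hs]
      have : (y k.opp : ℂ) - (y k : ℂ) * Complex.I
          = (y k.opp : ℂ) + ((-(y k) : ℝ) : ℂ) * Complex.I := by push_cast; ring
      rw [this, Complex.normSq_add_mul_I]; ring
  have hopp : ∑ k : Freq N, |lam L k.1| * y k.opp ^ 2 = ∑ k : Freq N, |lam L k.1| * y k ^ 2 :=
    Fintype.sum_equiv (oppEquiv N) _ _ fun k => by
      simp [oppEquiv, Freq.opp, lam_neg]
  have h : ∀ k : Freq N, |lam L k.1| * ((y k ^ 2 + y k.opp ^ 2) / 2)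
      = (|lam L k.1| * y k ^ 2 + |lam L k.1| * y k.opp ^ 2) / 2 := fun k => by ring
  rw [quadForm]
  simp only [key, h]
  rw [← Finset.sum_div, Finset.sum_add_distrib, hopp]
  ring

/-- In the variables `y = z / √ε` the exponent `V_N / ε` is the Gaussian exponent with the sign of
the unstable direction reversed, plus `ε w_N`. -/
theorem potential_sqrt_smul {L ε : ℝ} (hL0 : 0 < L) (hL : L < 2 * Real.pi) (hε : 0 < ε) {N : ℕ}
    (y : State N) :
    potential L ε (Real.sqrt ε • y) / ε
      = quadForm L y - y (zeroFreq N) ^ 2 + ε * wick L y := by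
  have hs : Real.sqrt ε ^ 2 = ε := Real.sq_sqrt hε.le
  have hs4 : Real.sqrt ε ^ 4 = ε ^ 2 := by
    rw [show Real.sqrt ε ^ 4 = (Real.sqrt ε ^ 2) ^ 2 by ring, hs]
  have h1 : ∑ k : Freq N, lam L k.1 * ‖coef (Real.sqrt ε • y) k‖ ^ 2
      = ε * ∑ k : Freq N, lam L k.1 * ‖coef y k‖ ^ 2 := by
    rw [Finset.mul_sum]
    refine Finset.sum_congr rfl fun k _ => ?_
    rw [coef_smul, norm_mul, mul_pow, Complex.norm_real, Real.norm_eq_abs, sq_abs, hs]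
    ring
  have h2 : ∑ k : Freq N, lam L k.1 * ‖coef y k‖ ^ 2
      = 2 * quadForm L y - 2 * y (zeroFreq N) ^ 2 := by
    have h3 : ∀ k : Freq N, lam L k.1 * ‖coef y k‖ ^ 2 = |lam L k.1| * ‖coef y k‖ ^ 2
        - if k = zeroFreq N then 2 * y (zeroFreq N) ^ 2 else 0 := by
      intro k
      split_ifs with h
      · subst h
        rw [norm_coef_zeroFreq]
        simp only [zeroFreq, lam_zero]
        norm_num
        ring
      · have : k.1 ≠ 0 := fun h' => h (Subtype.ext h')
        rw [abs_of_pos (lam_pos hL0 hL this), sub_zero]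
    rw [Finset.sum_congr rfl fun k _ => h3 k, Finset.sum_sub_distrib, quadForm]
    simp
  have h3 : (fun p => field L (Real.sqrt ε • y) p ^ 4
        - 6 * ε * renormConst L N * field L (Real.sqrt ε • y) p ^ 2
        + 3 * ε ^ 2 * renormConst L N ^ 2)
      = fun p => ε ^ 2 * (field L y p ^ 4 - 6 * renormConst L N * field L y p ^ 2
        + 3 * renormConst L N ^ 2) := by
    ext p
    rw [field_smul, mul_pow, mul_pow, hs, hs4]
    ring
  rw [potential, potentialOf, integral_gradSq_sub_sq hL0, h1, h2, h3, wick, torusIntegral_eq,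
    torusIntegral_eq, integral_const_mul]
  field_simp

/-! ### The Gaussian measure -/

section Product

theorem integral_euclidean_prod {ι : Type*} [Fintype ι] (f : ι → ℝ → ℝ) :
    ∫ y : EuclideanSpace ℝ ι, ∏ k, f k (y k) = ∏ k, ∫ t, f k t := by
  rw [← integral_fintype_prod_volume_eq_prod]
  exact (PiLp.volume_preserving_ofLp ι).integral_comp
    (MeasurableEquiv.toLp 2 (ι → ℝ)).symm.measurableEmbedding (fun y => ∏ k, f k (y k))

theorem integrable_euclidean_prod {ι : Type*} [Fintype ι] {f : ι → ℝ → ℝ}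
    (hf : ∀ k, Integrable (f k)) :
    Integrable (fun y : EuclideanSpace ℝ ι => ∏ k, f k (y k)) := by
  have h : Integrable (fun y : ι → ℝ => ∏ k, f k (y k)) (Measure.pi fun _ => volume) :=
    Integrable.fintype_prod hf
  exact ((PiLp.volume_preserving_ofLp ι).integrable_comp_emb
    (MeasurableEquiv.toLp 2 (ι → ℝ)).symm.measurableEmbedding).2 h

theorem integrable_pow_mul_exp {b : ℝ} (hb : 0 < b) (n : ℕ) :
    Integrable fun t : ℝ => t ^ n * Real.exp (-b * t ^ 2) := by
  have := integrable_rpow_mul_exp_neg_mul_sq hb (s := n)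
    (by have : (0 : ℝ) ≤ n := n.cast_nonneg; linarith)
  simpa only [Real.rpow_natCast] using this

/-- The recursion for the moments of a centred Gaussian variable. -/
theorem integral_pow_succ_mul_exp {b : ℝ} (hb : 0 < b) (n : ℕ) :
    ∫ t : ℝ, t ^ (n + 1) * Real.exp (-b * t ^ 2)
      = n / (2 * b) * ∫ t : ℝ, t ^ (n - 1) * Real.exp (-b * t ^ 2) := by
  have hd : ∀ t : ℝ, HasDerivAt (fun t => t ^ n * Real.exp (-b * t ^ 2))
      (n * (t ^ (n - 1) * Real.exp (-b * t ^ 2))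
        - 2 * b * (t ^ (n + 1) * Real.exp (-b * t ^ 2))) t := by
    intro t
    have h1 := ((hasDerivAt_pow 2 t).const_mul (-b)).exp
    refine ((hasDerivAt_pow n t).mul h1).congr_deriv ?_
    simp only [Nat.cast_ofNat, Nat.add_one_sub_one, pow_one]
    ring
  have hi := ((integrable_pow_mul_exp hb (n - 1)).const_mul (n : ℝ)).sub
    ((integrable_pow_mul_exp hb (n + 1)).const_mul (2 * b))
  have h0 := integral_eq_zero_of_hasDerivAt_of_integrable hd hi (integrable_pow_mul_exp hb n)
  rw [integral_sub ((integrable_pow_mul_exp hb (n - 1)).const_mul (n : ℝ))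
    ((integrable_pow_mul_exp hb (n + 1)).const_mul (2 * b)), integral_const_mul,
    integral_const_mul] at h0
  rw [div_mul_eq_mul_div, eq_div_iff (by positivity)]
  linarith

end Product

section Gauss

variable {L : ℝ} {N : ℕ}

theorem exp_neg_quadForm (L : ℝ) (y : State N) :
    Real.exp (-quadForm L y) = ∏ k : Freq N, Real.exp (-(|lam L k.1| / 2) * y k ^ 2) := by
  rw [quadForm_eq_sum_sq, ← Real.exp_sum, Finset.mul_sum, ← Finset.sum_neg_distrib]
  congr 1
  exact Finset.sum_congr rfl fun k _ => by ring

theorem monomial_mul_exp (L : ℝ) (s : Freq N →₀ ℕ) (a : ℝ) (y : State N) :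
    MvPolynomial.eval y.ofLp (MvPolynomial.monomial s a) * Real.exp (-quadForm L y)
      = a * ∏ k : Freq N, (y k ^ s k * Real.exp (-(|lam L k.1| / 2) * y k ^ 2)) := by
  rw [exp_neg_quadForm, MvPolynomial.eval_monomial, Finsupp.prod_fintype _ _ (fun _ => pow_zero _),
    Finset.prod_mul_distrib, mul_assoc]

variable (hL0 : 0 < L) (hL : L < 2 * Real.pi)
include hL0 hL

theorem integrable_eval_mul_exp (p : MvPolynomial (Freq N) ℝ) :
    Integrable fun y : State N => MvPolynomial.eval y.ofLp p * Real.exp (-quadForm L y) := by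
  induction p using MvPolynomial.induction_on' with
  | monomial s a =>
    simp only [monomial_mul_exp]
    exact (integrable_euclidean_prod
      (f := fun k t => t ^ s k * Real.exp (-(|lam L k.1| / 2) * t ^ 2))
      fun k => integrable_pow_mul_exp (half_pos (abs_lam_pos hL0 hL k.1)) _).const_mul a
  | add p q hp hq =>
    simp only [map_add, add_mul]
    exact hp.add hq

theorem integral_X_mul_exp (i : Freq N) (p : MvPolynomial (Freq N) ℝ) :
    ∫ y : State N, MvPolynomial.eval y.ofLp (MvPolynomial.X i * p) * Real.exp (-quadForm L y)
      = 1 / |lam L i.1| * ∫ y : State N, MvPolynomial.eval y.ofLp (MvPolynomial.pderiv i p)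
          * Real.exp (-quadForm L y) := by
  classical
  induction p using MvPolynomial.induction_on' with
  | monomial s a =>
    have h1 : MvPolynomial.X i * MvPolynomial.monomial s a
        = MvPolynomial.monomial (s + Finsupp.single i 1) a := by
      rw [MvPolynomial.X, MvPolynomial.monomial_mul, add_comm, one_mul]
    rw [h1, MvPolynomial.pderiv_monomial]
    simp only [monomial_mul_exp]
    rw [integral_const_mul, integral_const_mul,
      integral_euclidean_prod (f := fun k t => t ^ (s + Finsupp.single i 1 : Freq N →₀ ℕ) k
        * Real.exp (-(|lam L k.1| / 2) * t ^ 2)),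
      integral_euclidean_prod (f := fun k t => t ^ (s - Finsupp.single i 1 : Freq N →₀ ℕ) k
        * Real.exp (-(|lam L k.1| / 2) * t ^ 2)),
      ← Finset.mul_prod_erase _ _ (Finset.mem_univ i),
      ← Finset.mul_prod_erase _ _ (Finset.mem_univ i)]
    have h2 : ∀ k ∈ Finset.univ.erase i,
        ∫ t : ℝ, t ^ (s + Finsupp.single i 1 : Freq N →₀ ℕ) k
            * Real.exp (-(|lam L k.1| / 2) * t ^ 2)
          = ∫ t : ℝ, t ^ (s - Finsupp.single i 1 : Freq N →₀ ℕ) k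
            * Real.exp (-(|lam L k.1| / 2) * t ^ 2) := by
      intro k hk
      have : i ≠ k := fun h => (Finset.ne_of_mem_erase hk) h.symm
      simp [this]
    rw [Finset.prod_congr rfl h2]
    simp only [Finsupp.add_apply, Finsupp.tsub_apply, Finsupp.single_eq_same]
    rw [integral_pow_succ_mul_exp (half_pos (abs_lam_pos hL0 hL i.1))]
    ring
  | add p q hp hq =>
    simp only [mul_add, map_add, add_mul]
    rw [integral_add, integral_add, mul_add, hp, hq]
    · exact integrable_eval_mul_exp hL0 hL _
    · exact integrable_eval_mul_exp hL0 hL _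
    · exact integrable_eval_mul_exp hL0 hL _
    · exact integrable_eval_mul_exp hL0 hL _

theorem integrable_exp_neg_quadForm : Integrable fun y : State N => Real.exp (-quadForm L y) := by
  simpa using integrable_eval_mul_exp (N := N) hL0 hL 1

/-- The Gaussian normalisation constant; the zero mode contributes the factor `√(2π)`. -/
theorem integral_exp_neg_quadForm :
    ∫ y : State N, Real.exp (-quadForm L y)
      = Real.sqrt (2 * Real.pi) * ∏ k ∈ (freqs N).erase 0, Real.sqrt (2 * Real.pi / lam L k) := by
  simp only [exp_neg_quadForm]
  rw [integral_euclidean_prod (f := fun (k : Freq N) t => Real.exp (-(|lam L k.1| / 2) * t ^ 2))]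
  simp only [integral_gaussian]
  rw [Finset.univ_eq_attach, Finset.prod_attach (freqs N)
    (fun k => Real.sqrt (Real.pi / (|lam L k| / 2))),
    ← Finset.mul_prod_erase _ _ (zeroFreq N).2]
  congr 1
  · simp [zeroFreq, lam_zero, mul_comm]
  · refine Finset.prod_congr rfl fun k hk => ?_
    rw [abs_of_pos (lam_pos hL0 hL (Finset.ne_of_mem_erase hk))]
    congr 1
    field_simp

theorem integral_exp_neg_quadForm_pos : 0 < ∫ y : State N, Real.exp (-quadForm L y) := by
  rw [integral_exp_neg_quadForm hL0 hL]
  have := Real.pi_pos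
  refine mul_pos (by positivity) (Finset.prod_pos fun k hk => ?_)
  have := lam_pos hL0 hL (Finset.ne_of_mem_erase hk)
  positivity

omit hL0 hL in
@[fun_prop]
theorem continuous_quadForm (L : ℝ) : Continuous fun y : State N => quadForm L y := by
  simp only [quadForm_eq_sum_sq]
  fun_prop

theorem gauss_eq : gauss L N = (ENNReal.ofReal (∫ y : State N, Real.exp (-quadForm L y)))⁻¹ •
    (volume : Measure (State N)).withDensity
      (fun y => ENNReal.ofReal (Real.exp (-quadForm L y))) := by
  rw [gauss, ofReal_integral_eq_lintegral_ofReal (integrable_exp_neg_quadForm hL0 hL)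
    (Filter.Eventually.of_forall fun y => (Real.exp_pos _).le)]

theorem integrable_gauss_iff {f : State N → ℝ} :
    Integrable f (gauss L N) ↔ Integrable fun y => f y * Real.exp (-quadForm L y) := by
  have hZ := integral_exp_neg_quadForm_pos (N := N) hL0 hL
  rw [gauss_eq hL0 hL, integrable_smul_measure (by simp) (by simpa using hZ),
    integrable_withDensity_iff (by fun_prop) (by simp)]
  simp only [ENNReal.toReal_ofReal (Real.exp_pos _).le]

theorem integral_gauss (f : State N → ℝ) :
    ∫ y, f y ∂(gauss L N) = (∫ y : State N, Real.exp (-quadForm L y))⁻¹ *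
      ∫ y, f y * Real.exp (-quadForm L y) := by
  have hZ := integral_exp_neg_quadForm_pos (N := N) hL0 hL
  rw [gauss_eq hL0 hL, integral_smul_measure,
    integral_withDensity_eq_integral_toReal_smul (by fun_prop) (by simp)]
  simp only [ENNReal.toReal_ofReal (Real.exp_pos _).le, ENNReal.toReal_inv,
    ENNReal.toReal_ofReal hZ.le, smul_eq_mul, mul_comm (f _)]

theorem isProbabilityMeasure_gauss : IsProbabilityMeasure (gauss L N) := by
  have hZ := integral_exp_neg_quadForm_pos (N := N) hL0 hL
  constructor
  rw [gauss_eq hL0 hL, Measure.smul_apply, withDensity_apply _ MeasurableSet.univ,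
    Measure.restrict_univ, ← ofReal_integral_eq_lintegral_ofReal
      (integrable_exp_neg_quadForm hL0 hL)
      (Filter.Eventually.of_forall fun y => (Real.exp_pos _).le),
    smul_eq_mul, ENNReal.inv_mul_cancel (by simpa using hZ) (by simp)]

theorem integrable_eval_gauss (p : MvPolynomial (Freq N) ℝ) :
    Integrable (fun y : State N => MvPolynomial.eval y.ofLp p) (gauss L N) :=
  (integrable_gauss_iff hL0 hL).2 (integrable_eval_mul_exp hL0 hL p)

omit hL0 hL in
/-- The expectation of a polynomial under `gauss L N`, as a linear functional. -/
def gaussExpectation (hL0 : 0 < L) (hL : L < 2 * Real.pi) (N : ℕ) :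
    MvPolynomial (Freq N) ℝ →ₗ[ℝ] ℝ where
  toFun p := ∫ y, MvPolynomial.eval y.ofLp p ∂(gauss L N)
  map_add' p q := by
    simp only [map_add]
    exact integral_add (integrable_eval_gauss hL0 hL p) (integrable_eval_gauss hL0 hL q)
  map_smul' c p := by
    simp only [MvPolynomial.smul_eval, integral_const_mul, RingHom.id_apply, smul_eq_mul]

theorem gaussExpectation_apply (p : MvPolynomial (Freq N) ℝ) :
    gaussExpectation hL0 hL N p = ∫ y, MvPolynomial.eval y.ofLp p ∂(gauss L N) := rfl

theorem isGaussianExpectation_gauss :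
    IsGaussianExpectation (fun k : Freq N => 1 / |lam L k.1|) (gaussExpectation hL0 hL N) where
  map_one := by
    have := isProbabilityMeasure_gauss (N := N) hL0 hL
    simp [gaussExpectation_apply]
  nonneg p hp := integral_nonneg fun y => hp y.ofLp
  stein i p := by
    rw [gaussExpectation_apply, gaussExpectation_apply, integral_gauss hL0 hL,
      integral_gauss hL0 hL, integral_X_mul_exp hL0 hL]
    ring

end Gauss

/-! ### The renormalised quartic as an element of the fourth chaos -/

section Hermite

open MvPolynomial

variable {ι : Type*} [Fintype ι]

/-- The fourth Hermite polynomial, with variance parameter `c`, of the linear form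
`∑ i, b i * X i`. -/
def hermPoly (c : ℝ) (b : ι → ℝ) : MvPolynomial ι ℝ :=
  (∑ i, C (b i) * X i) ^ 4 - C (6 * c) * (∑ i, C (b i) * X i) ^ 2 + C (3 * c ^ 2)

theorem pderiv_linear (b : ι → ℝ) (j : ι) :
    pderiv j (∑ i, C (b i) * X i : MvPolynomial ι ℝ) = C (b j) := by
  classical
  simp [pderiv_X, Pi.single_apply]

theorem pderiv_hermPoly (c : ℝ) (b : ι → ℝ) (j : ι) :
    pderiv j (hermPoly c b) = C (b j) * (C 4 * (∑ i, C (b i) * X i) ^ 3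
      - C (12 * c) * (∑ i, C (b i) * X i)) := by
  simp only [hermPoly, map_add, map_sub, pderiv_C_mul, Derivation.leibniz_pow, pderiv_linear,
    pderiv_C]
  simp only [nsmul_eq_mul, smul_eq_mul, C_mul, map_ofNat]
  push_cast
  ring

theorem pderiv_pderiv_hermPoly (c : ℝ) (b : ι → ℝ) (i j : ι) :
    pderiv i (pderiv j (hermPoly c b)) = C (b j) * (C (b i) * (C 12 * (∑ i, C (b i) * X i) ^ 2
      - C (12 * c))) := by
  rw [pderiv_hermPoly]
  simp only [map_sub, pderiv_C_mul, Derivation.leibniz_pow, pderiv_linear]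
  simp only [nsmul_eq_mul, smul_eq_mul, C_mul, map_ofNat]
  push_cast
  ring

theorem pderiv_four_hermPoly (c : ℝ) (b : ι → ℝ) (i j k l : ι) :
    pderiv i (pderiv j (pderiv k (pderiv l (hermPoly c b))))
      = C (24 * (b i * b j * b k * b l)) := by
  have h3 : pderiv j (pderiv k (pderiv l (hermPoly c b)))
      = C (24 * (b j * b k * b l)) * ∑ i, C (b i) * X i := by
    rw [pderiv_pderiv_hermPoly]
    simp only [map_sub, pderiv_C_mul, Derivation.leibniz_pow, pderiv_linear, pderiv_C]
    simp only [nsmul_eq_mul, smul_eq_mul, C_mul, map_ofNat]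
    push_cast
    ring
  rw [h3, pderiv_C_mul, pderiv_linear, ← C_mul]
  congr 1
  ring

theorem hermPoly_mem_chaos {v : ι → ℝ} {c : ℝ} {b : ι → ℝ} (hc : ∑ i, v i * b i ^ 2 = c) :
    hermPoly c b ∈ chaos v 4 := by
  rw [mem_chaos, numberOp_apply]
  simp only [pderiv_pderiv_hermPoly, smul_eq_C_mul]
  simp only [pderiv_hermPoly]
  set ℓ : MvPolynomial ι ℝ := ∑ i, C (b i) * X i with hℓ
  rw [Finset.sum_sub_distrib]
  have h1 : ∑ i, X i * (C (b i) * (C 4 * ℓ ^ 3 - C (12 * c) * ℓ))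
      = ℓ * (C 4 * ℓ ^ 3 - C (12 * c) * ℓ) := by
    conv_rhs => rw [hℓ, Finset.sum_mul, ← hℓ]
    exact Finset.sum_congr rfl fun i _ => by ring
  have h2 : ∑ i, C (v i) * (C (b i) * (C (b i) * (C 12 * ℓ ^ 2 - C (12 * c))))
      = C c * (C 12 * ℓ ^ 2 - C (12 * c)) := by
    conv_rhs => rw [← hc, map_sum, Finset.sum_mul, hc]
    refine Finset.sum_congr rfl fun i _ => ?_
    simp only [C_mul, map_pow]; ring
  rw [h1, h2, hermPoly]
  simp only [C_mul, map_pow, map_ofNat, Nat.cast_ofNat]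
  ring

/-- The integral over the torus of `hermPoly c (b · p)`, as a polynomial in the coordinates. -/
def wickPoly (L c : ℝ) (b : ι → ℝ × ℝ → ℝ) : MvPolynomial ι ℝ :=
  (∑ i, ∑ j, ∑ k, ∑ l, torusIntegral L (fun p => b i p * b j p * b k p * b l p) •
      (X i * (X j * (X k * X l)) : MvPolynomial ι ℝ))
    - (6 * c) • (∑ i, ∑ j, torusIntegral L (fun p => b i p * b j p) •
      (X i * X j : MvPolynomial ι ℝ))
    + (torusIntegral L fun _ => 3 * c ^ 2) • (1 : MvPolynomial ι ℝ)

/-- Linear functionals commute with the integral defining `wickPoly`. -/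
theorem map_wickPoly (L c : ℝ) {b : ι → ℝ × ℝ → ℝ} (hb : ∀ i, Continuous (b i))
    (Φ : MvPolynomial ι ℝ →ₗ[ℝ] ℝ) :
    Φ (wickPoly L c b) = torusIntegral L fun p => Φ (hermPoly c fun i => b i p) := by
  have h : ∀ p, Φ (hermPoly c fun i => b i p)
      = (∑ i, ∑ j, ∑ k, ∑ l, (b i p * b j p * b k p * b l p) * Φ (X i * (X j * (X k * X l))))
        - 6 * c * (∑ i, ∑ j, (b i p * b j p) * Φ (X i * X j)) + 3 * c ^ 2 * Φ 1 := by
    intro p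
    have e4 : (∑ i, C (b i p) * X i : MvPolynomial ι ℝ) ^ 4
        = ∑ i, ∑ j, ∑ k, ∑ l, (b i p * b j p * b k p * b l p) • (X i * (X j * (X k * X l))) := by
      rw [show ∀ x : MvPolynomial ι ℝ, x ^ 4 = x * x * x * x from fun x => by ring, four_sum_mul]
      refine Finset.sum_congr rfl fun i _ => Finset.sum_congr rfl fun j _ =>
        Finset.sum_congr rfl fun k _ => Finset.sum_congr rfl fun l _ => ?_
      simp only [smul_eq_C_mul, C_mul]
      ring
    have e2 : (∑ i, C (b i p) * X i : MvPolynomial ι ℝ) ^ 2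
        = ∑ i, ∑ j, (b i p * b j p) • (X i * X j) := by
      rw [sq, Finset.sum_mul_sum]
      refine Finset.sum_congr rfl fun i _ => Finset.sum_congr rfl fun j _ => ?_
      simp only [smul_eq_C_mul, C_mul]
      ring
    rw [hermPoly, e4, e2, ← smul_eq_C_mul, ← mul_one (C (3 * c ^ 2)), ← smul_eq_C_mul]
    simp only [map_add, map_sub, map_smul, map_sum, smul_eq_mul]
  simp only [h]
  rw [torusIntegral_eq, integral_add (Continuous.integrable_torusMeasure (by fun_prop) L)
      (Continuous.integrable_torusMeasure (by fun_prop) L),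
    integral_sub (Continuous.integrable_torusMeasure (by fun_prop) L)
      (Continuous.integrable_torusMeasure (by fun_prop) L), integral_const_mul, integral_mul_const]
  rw [integral_finsetSum _ fun i _ => Continuous.integrable_torusMeasure (by fun_prop) L,
    integral_finsetSum _ fun i _ => Continuous.integrable_torusMeasure (by fun_prop) L]
  simp only [wickPoly, map_add, map_sub, map_smul, map_sum, smul_eq_mul]
  congr 2
  · refine Finset.sum_congr rfl fun i _ => ?_
    rw [integral_finsetSum _ fun j _ => Continuous.integrable_torusMeasure (by fun_prop) L]
    refine Finset.sum_congr rfl fun j _ => ?_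
    rw [integral_finsetSum _ fun k _ => Continuous.integrable_torusMeasure (by fun_prop) L]
    refine Finset.sum_congr rfl fun k _ => ?_
    rw [integral_finsetSum _ fun l _ => Continuous.integrable_torusMeasure (by fun_prop) L]
    refine Finset.sum_congr rfl fun l _ => ?_
    rw [integral_mul_const, torusIntegral_eq]
  · congr 1
    refine Finset.sum_congr rfl fun i _ => ?_
    rw [integral_finsetSum _ fun j _ => Continuous.integrable_torusMeasure (by fun_prop) L]
    refine Finset.sum_congr rfl fun j _ => ?_
    rw [integral_mul_const, torusIntegral_eq]

/-- Evaluation at a point, as a linear functional on polynomials. -/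
def evalLinear (y : ι → ℝ) : MvPolynomial ι ℝ →ₗ[ℝ] ℝ := (aeval y).toLinearMap

omit [Fintype ι] in
theorem evalLinear_apply (y : ι → ℝ) (p : MvPolynomial ι ℝ) : evalLinear y p = eval y p := by
  simp [evalLinear, aeval_eq_eval]

theorem eval_hermPoly (c : ℝ) (b y : ι → ℝ) :
    eval y (hermPoly c b) = (∑ i, y i * b i) ^ 4 - 6 * c * (∑ i, y i * b i) ^ 2 + 3 * c ^ 2 := by
  simp [hermPoly, mul_comm]

theorem eval_wickPoly (L c : ℝ) {b : ι → ℝ × ℝ → ℝ} (hb : ∀ i, Continuous (b i)) (y : ι → ℝ) :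
    eval y (wickPoly L c b) = torusIntegral L fun p =>
      (∑ i, y i * b i p) ^ 4 - 6 * c * (∑ i, y i * b i p) ^ 2 + 3 * c ^ 2 := by
  rw [← evalLinear_apply, map_wickPoly L c hb]
  simp only [evalLinear_apply, eval_hermPoly]

theorem wickPoly_mem_chaos (L : ℝ) {v : ι → ℝ} {c : ℝ} {b : ι → ℝ × ℝ → ℝ}
    (hb : ∀ i, Continuous (b i)) (hc : ∀ p, ∑ i, v i * b i p ^ 2 = c) :
    wickPoly L c b ∈ chaos v 4 := by
  rw [chaos, LinearMap.mem_ker]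
  apply MvPolynomial.funext
  intro y
  rw [← evalLinear_apply, ← LinearMap.comp_apply, map_wickPoly L c hb, map_zero]
  have : ∀ p, (numberOp v - ((4 : ℕ) : ℝ) • (LinearMap.id : MvPolynomial ι ℝ →ₗ[ℝ] _))
      (hermPoly c fun i => b i p) = 0 := fun p => by
    have := hermPoly_mem_chaos (hc p)
    rwa [chaos, LinearMap.mem_ker] at this
  simp only [LinearMap.comp_apply, this, map_zero]
  simp [torusIntegral_eq]

theorem pderiv_four_wickPoly (L c : ℝ) {b : ι → ℝ × ℝ → ℝ} (hb : ∀ i, Continuous (b i))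
    (i j k l : ι) : pderiv i (pderiv j (pderiv k (pderiv l (wickPoly L c b))))
      = C (24 * torusIntegral L fun p => b i p * b j p * b k p * b l p) := by
  apply MvPolynomial.funext
  intro y
  have := map_wickPoly L c hb (evalLinear y ∘ₗ (pderiv i).toLinearMap ∘ₗ (pderiv j).toLinearMap ∘ₗ
    (pderiv k).toLinearMap ∘ₗ (pderiv l).toLinearMap)
  simp only [LinearMap.comp_apply, Derivation.coeFn_coe,
    pderiv_four_hermPoly, evalLinear_apply, eval_C] at this
  rw [this, eval_C, torusIntegral_eq, integral_const_mul, torusIntegral_eq]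

/-- Completing the square: `t⁴ - 6ct² + 3c² = (t² - 3c)² - 6c²`. -/
theorem eval_wickPoly_ge {L : ℝ} (hL : 0 ≤ L) (c : ℝ) {b : ι → ℝ × ℝ → ℝ}
    (hb : ∀ i, Continuous (b i)) (y : ι → ℝ) : -(6 * L ^ 2 * c ^ 2) ≤ eval y (wickPoly L c b) := by
  rw [eval_wickPoly L c hb, torusIntegral_eq]
  have h1 : ∫ _p, -(6 * c ^ 2) ∂(torusMeasure L) = -(6 * L ^ 2 * c ^ 2) := by
    rw [integral_const, torusMeasure_real_univ hL, smul_eq_mul]; ring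
  rw [← h1]
  refine integral_mono (integrable_const _) (Continuous.integrable_torusMeasure (by fun_prop) L)
    fun p => ?_
  have := sq_nonneg ((∑ i, y i * b i p) ^ 2 - 3 * c)
  beta_reduce
  linarith

end Hermite

/-! ### Ultraviolet truncations of the renormalised quartic -/

theorem mem_freqs {M : ℕ} {k : ℤ × ℤ} : k ∈ freqs M ↔ |k.1| ≤ M ∧ |k.2| ≤ M := by
  simp only [freqs, Finset.mem_product, Finset.mem_Icc, abs_le]

theorem freqs_mono {M N : ℕ} (h : M ≤ N) : freqs M ⊆ freqs N := by
  intro k hk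
  rw [mem_freqs] at hk ⊢
  have : (M : ℤ) ≤ N := by exact_mod_cast h
  exact ⟨hk.1.trans this, hk.2.trans this⟩

/-- The real modes, cut off at frequencies at most `M`. -/
def truncMode (L : ℝ) (N M : ℕ) (k : Freq N) (p : ℝ × ℝ) : ℝ :=
  if k.1 ∈ freqs M then mode L k.1 p else 0

theorem continuous_truncMode (L : ℝ) (N M : ℕ) (k : Freq N) : Continuous (truncMode L N M k) := by
  unfold truncMode
  split_ifs <;> fun_prop

theorem sum_truncMode_sq (L : ℝ) (N M : ℕ) (p : ℝ × ℝ) :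
    ∑ k : Freq N, 1 / |lam L k.1| * truncMode L N M k p ^ 2 = renormConst L (min M N) := by
  rw [← sum_mode_sq L (min M N) p, Finset.univ_eq_attach]
  have h1 : ∀ k : Freq N, 1 / |lam L k.1| * truncMode L N M k p ^ 2
      = (fun k : ℤ × ℤ => if k ∈ freqs M then 1 / |lam L k| * mode L k p ^ 2 else 0) k.1 := by
    intro k
    simp only [truncMode]
    split_ifs <;> simp
  rw [Finset.sum_congr rfl fun k _ => h1 k, Finset.sum_attach (freqs N)
    (fun k : ℤ × ℤ => if k ∈ freqs M then 1 / |lam L k| * mode L k p ^ 2 else 0),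
    ← Finset.sum_filter]
  congr 1
  ext k
  rcases le_total M N with h | h
  · rw [min_eq_left h, Finset.mem_filter]
    exact ⟨fun h' => h'.2, fun h' => ⟨freqs_mono h h', h'⟩⟩
  · rw [min_eq_right h, Finset.mem_filter]
    exact ⟨fun h' => h'.1, fun h' => ⟨h', freqs_mono h h'⟩⟩

/-- The renormalised quartic of the field truncated at frequencies at most `M`, with its own
renormalisation constant, as a polynomial on `State N`. -/
def wickTrunc (L : ℝ) (N M : ℕ) : MvPolynomial (Freq N) ℝ :=
  (1 / 4 : ℝ) • wickPoly L (renormConst L (min M N)) (truncMode L N M)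

theorem wickTrunc_mem_chaos (L : ℝ) (N M : ℕ) :
    wickTrunc L N M ∈ chaos (fun k : Freq N => 1 / |lam L k.1|) 4 :=
  Submodule.smul_mem _ _ (wickPoly_mem_chaos L (continuous_truncMode L N M)
    (sum_truncMode_sq L N M))

theorem wickTrunc_eq_of_le (L : ℝ) {N M : ℕ} (h : N ≤ M) : wickTrunc L N M = wickTrunc L N N := by
  have : truncMode L N M = truncMode L N N := by
    ext k p
    simp only [truncMode, k.2, freqs_mono h k.2]
  rw [wickTrunc, wickTrunc, this, min_eq_right h, min_self]

theorem eval_wickTrunc_self (L : ℝ) {N : ℕ} (y : State N) :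
    MvPolynomial.eval y.ofLp (wickTrunc L N N) = wick L y := by
  have h : ∀ p, ∑ k : Freq N, y k * truncMode L N N k p = field L y p := by
    intro p
    rw [field_eq_sum_mode]
    refine Finset.sum_congr rfl fun k _ => ?_
    rw [truncMode, if_pos k.2]
  rw [wickTrunc, MvPolynomial.smul_eval, eval_wickPoly L _ (continuous_truncMode L N N), wick,
    min_self]
  simp only [h]

theorem eval_wickTrunc_ge {L : ℝ} (hL : 0 ≤ L) (N M : ℕ) (y : Freq N → ℝ) :
    -(3 / 2 * L ^ 2 * renormConst L M ^ 2) ≤ MvPolynomial.eval y (wickTrunc L N M) := by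
  have h := eval_wickPoly_ge hL (renormConst L (min M N)) (continuous_truncMode L N M) y
  have h0 : ∀ K, 0 ≤ renormConst L K := fun K =>
    mul_nonneg (by positivity) (Finset.sum_nonneg fun k _ => by positivity)
  have h1 : renormConst L (min M N) ≤ renormConst L M := by
    unfold renormConst
    gcongr
    exact freqs_mono (min_le_left _ _)
  have h2 : renormConst L (min M N) ^ 2 ≤ renormConst L M ^ 2 := by
    have := h0 (min M N)
    gcongr
  rw [wickTrunc, MvPolynomial.smul_eval]
  have h3 := mul_le_mul_of_nonneg_left h2 (by positivity : 0 ≤ 3 / 2 * L ^ 2)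
  linarith

/-- The fourth derivative of the difference of two truncations keeps the interactions that involve
at least one frequency above the lower cutoff. -/
theorem pderiv_four_sub_wickTrunc (L : ℝ) (N M : ℕ) (i j k l : Freq N) :
    MvPolynomial.pderiv i (MvPolynomial.pderiv j (MvPolynomial.pderiv k
      (MvPolynomial.pderiv l (wickTrunc L N N - wickTrunc L N M))))
    = MvPolynomial.C (if i.1 ∈ freqs M ∧ j.1 ∈ freqs M ∧ k.1 ∈ freqs M ∧ l.1 ∈ freqs M then 0
      else 6 * torusIntegral L fun p =>
        mode L i.1 p * mode L j.1 p * mode L k.1 p * mode L l.1 p) := by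
  have h : ∀ M, MvPolynomial.pderiv i (MvPolynomial.pderiv j (MvPolynomial.pderiv k
      (MvPolynomial.pderiv l (wickTrunc L N M))))
      = MvPolynomial.C (6 * torusIntegral L fun p => truncMode L N M i p * truncMode L N M j p
        * truncMode L N M k p * truncMode L N M l p) := by
    intro M
    rw [wickTrunc]
    simp only [Derivation.map_smul]
    rw [pderiv_four_wickPoly L _ (continuous_truncMode L N M), MvPolynomial.smul_eq_C_mul,
      ← map_mul]
    congr 1
    ring
  simp only [map_sub, h]
  rw [← map_sub]
  congr 1
  have e : ∀ k : Freq N, truncMode L N N k = mode L k.1 := fun k => by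
    ext p; rw [truncMode, if_pos k.2]
  simp only [e]
  split_ifs with hM
  · simp only [truncMode, hM, if_true, sub_self]
  · have : ∀ p, truncMode L N M i p * truncMode L N M j p
        * truncMode L N M k p * truncMode L N M l p = 0 := by
      intro p
      by_contra h0
      simp only [mul_eq_zero, not_or] at h0
      refine hM ⟨?_, ?_, ?_, ?_⟩ <;> by_contra h1
      · exact h0.1.1.1 (if_neg h1)
      · exact h0.1.1.2 (if_neg h1)
      · exact h0.1.2 (if_neg h1)
      · exact h0.2 (if_neg h1)
    simp [this, torusIntegral_eq]

/-! ### Summation over resonant frequencies -/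

theorem sum_constrained_le {κ : Type*} [Fintype κ] {u : κ → ℝ} (hu : ∀ k, 0 ≤ u k)
    (P : κ → κ → κ → κ → Prop) [∀ i j k l, Decidable (P i j k l)]
    (hP : ∀ j k l i i', P i j k l → P i' j k l → i = i') :
    ∑ i, ∑ j, ∑ k, ∑ l, (if P i j k l then u j * u k * u l else 0) ≤ (∑ k, u k) ^ 3 := by
  have h1 : ∑ i, ∑ j, ∑ k, ∑ l, (if P i j k l then u j * u k * u l else 0)
      = ∑ j, ∑ k, ∑ l, ∑ i, (if P i j k l then u j * u k * u l else 0) := by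
    rw [Finset.sum_comm]
    refine Finset.sum_congr rfl fun j _ => ?_
    rw [Finset.sum_comm]
    refine Finset.sum_congr rfl fun k _ => ?_
    rw [Finset.sum_comm]
  have h2 : (∑ k, u k) ^ 3 = ∑ j, ∑ k, ∑ l, u j * u k * u l := by
    rw [pow_succ, sq, Finset.sum_mul_sum, Finset.sum_mul]
    refine Finset.sum_congr rfl fun j _ => ?_
    rw [Finset.sum_mul]
    refine Finset.sum_congr rfl fun k _ => ?_
    rw [Finset.mul_sum]
  rw [h1, h2]
  refine Finset.sum_le_sum fun j _ => Finset.sum_le_sum fun k _ => Finset.sum_le_sum fun l _ => ?_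
  have hnn : 0 ≤ u j * u k * u l := mul_nonneg (mul_nonneg (hu _) (hu _)) (hu _)
  by_cases hex : ∃ i, P i j k l
  · obtain ⟨i, hi⟩ := hex
    rw [Finset.sum_eq_single i]
    · rw [if_pos hi]
    · intro i' _ hne
      exact if_neg fun h => hne (hP j k l i' i h hi)
    · exact fun h => absurd (Finset.mem_univ i) h
  · push Not at hex
    simp [hex, hnn]

/-- Young's inequality for a four-fold convolution at one point, in a form where the constraint
determines each index from the other three. -/
theorem sum_four_constrained_le {κ : Type*} [Fintype κ] {t : κ → ℝ}
    (P : κ → κ → κ → κ → Prop) [∀ i j k l, Decidable (P i j k l)]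
    (h1 : ∀ i i' j k l, P i j k l → P i' j k l → i = i')
    (h2 : ∀ i j j' k l, P i j k l → P i j' k l → j = j')
    (h3 : ∀ i j k k' l, P i j k l → P i j k' l → k = k')
    (h4 : ∀ i j k l l', P i j k l → P i j k l' → l = l') :
    ∑ i, ∑ j, ∑ k, ∑ l, (if P i j k l then t i ^ 3 * t j ^ 3 * t k ^ 3 * t l ^ 3 else 0)
      ≤ (∑ k, t k ^ 4) ^ 3 := by
  have hu : ∀ k, 0 ≤ t k ^ 4 := fun k => by positivity
  have amgm : ∀ a b c d : ℝ, a * b * c * d ≤ (a ^ 4 + b ^ 4 + c ^ 4 + d ^ 4) / 4 := by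
    intro a b c d
    nlinarith [sq_nonneg (a * b - c * d), sq_nonneg (a ^ 2 - b ^ 2), sq_nonneg (c ^ 2 - d ^ 2)]
  have e1 := sum_constrained_le hu P (fun j k l i i' => h1 i i' j k l)
  have e2 := sum_constrained_le hu (fun j i k l => P i j k l) (fun i k l j j' => h2 i j j' k l)
  have e3 := sum_constrained_le hu (fun k i j l => P i j k l) (fun i j l k k' => h3 i j k k' l)
  have e4 := sum_constrained_le hu (fun l i j k => P i j k l) (fun i j k l l' => h4 i j k l l')
  rw [Finset.sum_comm] at e2
  have e3' : ∑ k, ∑ i, ∑ j, ∑ l, (if P i j k l then t i ^ 4 * t j ^ 4 * t l ^ 4 else 0)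
      = ∑ i, ∑ j, ∑ k, ∑ l, (if P i j k l then t i ^ 4 * t j ^ 4 * t l ^ 4 else 0) := by
    rw [Finset.sum_comm]
    refine Finset.sum_congr rfl fun i _ => ?_
    rw [Finset.sum_comm]
  have e4' : ∑ l, ∑ i, ∑ j, ∑ k, (if P i j k l then t i ^ 4 * t j ^ 4 * t k ^ 4 else 0)
      = ∑ i, ∑ j, ∑ k, ∑ l, (if P i j k l then t i ^ 4 * t j ^ 4 * t k ^ 4 else 0) := by
    rw [Finset.sum_comm]
    refine Finset.sum_congr rfl fun i _ => ?_
    rw [Finset.sum_comm]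
    refine Finset.sum_congr rfl fun j _ => ?_
    rw [Finset.sum_comm]
  rw [e3'] at e3
  rw [e4'] at e4
  have key : ∑ i, ∑ j, ∑ k, ∑ l, (if P i j k l then t i ^ 3 * t j ^ 3 * t k ^ 3 * t l ^ 3 else 0)
      ≤ ∑ i, ∑ j, ∑ k, ∑ l, ((if P i j k l then t j ^ 4 * t k ^ 4 * t l ^ 4 else 0)
        + (if P i j k l then t i ^ 4 * t k ^ 4 * t l ^ 4 else 0)
        + (if P i j k l then t i ^ 4 * t j ^ 4 * t l ^ 4 else 0)
        + (if P i j k l then t i ^ 4 * t j ^ 4 * t k ^ 4 else 0)) / 4 := by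
    refine Finset.sum_le_sum fun i _ => Finset.sum_le_sum fun j _ => Finset.sum_le_sum fun k _ =>
      Finset.sum_le_sum fun l _ => ?_
    split_ifs
    · have := amgm (t j * t k * t l) (t i * t k * t l) (t i * t j * t l) (t i * t j * t k)
      calc _ = (t j * t k * t l) * (t i * t k * t l) * (t i * t j * t l)
            * (t i * t j * t k) := by ring
        _ ≤ _ := this
        _ = _ := by ring
    · simp
  simp only [← Finset.sum_div, Finset.sum_add_distrib] at key
  linarith

/-- The weight `((1 ∨ |k₁|) (1 ∨ |k₂|))^{-7/24}`, whose fourth power is summable over `ℤ²`. -/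
def freqWeight (k : ℤ × ℤ) : ℝ :=
  ((max 1 |(k.1 : ℝ)|) ^ (-(7 / 24) : ℝ)) * ((max 1 |(k.2 : ℝ)|) ^ (-(7 / 24) : ℝ))

theorem freqWeight_nonneg (k : ℤ × ℤ) : 0 ≤ freqWeight k := by
  unfold freqWeight; positivity

theorem summable_freqWeight : Summable fun k : ℤ × ℤ => freqWeight k ^ 4 := by
  have h1 : Summable fun n : ℤ => (max 1 |(n : ℝ)|) ^ (-(7 / 6) : ℝ) := by
    have h2 : Summable fun n : ℤ => |(n : ℝ)| ^ (-(7 / 6) : ℝ) :=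
      Real.summable_abs_int_rpow (by norm_num)
    refine h2.of_norm_bounded_eventually ?_
    rw [Filter.eventually_cofinite]
    refine (Set.finite_singleton (0 : ℤ)).subset fun n hn => ?_
    by_contra h0
    have h0' : n ≠ 0 := h0
    have : (1 : ℝ) ≤ |(n : ℝ)| := by
      have := Int.one_le_abs h0'
      exact_mod_cast this
    apply hn
    rw [Real.norm_of_nonneg (by positivity), max_eq_right this]
  have h3 := h1.mul_of_nonneg h1 (fun n => by positivity) (fun n => by positivity)
  refine h3.congr fun k => ?_
  have : ∀ n : ℤ, ((max 1 |(n : ℝ)|) ^ (-(7 / 24) : ℝ)) ^ 4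
      = (max 1 |(n : ℝ)|) ^ (-(7 / 6) : ℝ) := by
    intro n
    rw [← Real.rpow_natCast, ← Real.rpow_mul (by positivity)]
    norm_num
  rw [freqWeight, mul_pow, this, this]

theorem inv_abs_lam_le {L : ℝ} (hL0 : 0 < L) (hL : L < 2 * Real.pi) :
    ∃ c : ℝ, 0 < c ∧ ∀ k : ℤ × ℤ,
      1 / |lam L k| ≤ c / (max 1 (max |(k.1 : ℝ)| |(k.2 : ℝ)|)) ^ 2 := by
  have h1 : 1 < 2 * Real.pi / L := by rwa [lt_div_iff₀ hL0, one_mul]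
  set a := (2 * Real.pi / L) ^ 2 with ha
  have ha1 : 0 < a - 1 := by nlinarith
  refine ⟨max 1 (1 / (a - 1)), by positivity, fun k => ?_⟩
  rcases eq_or_ne k 0 with rfl | hk
  · simp [lam_zero]
  · have hlam := lam_pos hL0 hL hk
    rw [abs_of_pos hlam]
    set m := max |(k.1 : ℝ)| |(k.2 : ℝ)| with hm
    have hm1 : 1 ≤ m := by
      have : (1 : ℤ) ≤ max |k.1| |k.2| := by
        rw [le_max_iff]
        by_contra h
        push Not at h
        exact hk (Prod.ext (Int.abs_lt_one_iff.1 h.1) (Int.abs_lt_one_iff.1 h.2))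
      rw [hm]
      exact_mod_cast this
    have hmsq : m ^ 2 ≤ (k.1 : ℝ) ^ 2 + (k.2 : ℝ) ^ 2 := by
      rcases max_choice |(k.1 : ℝ)| |(k.2 : ℝ)| with h | h <;> rw [hm, h, sq_abs] <;>
        nlinarith [sq_nonneg (k.1 : ℝ), sq_nonneg (k.2 : ℝ)]
    rw [max_eq_right hm1]
    have h2 : (a - 1) * m ^ 2 ≤ lam L k := by
      have h3 : lam L k = a * ((k.1 : ℝ) ^ 2 + (k.2 : ℝ) ^ 2) - 1 := rfl
      rw [h3]
      nlinarith
    calc 1 / lam L k ≤ 1 / ((a - 1) * m ^ 2) := by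
          apply one_div_le_one_div_of_le (by positivity) h2
      _ = (1 / (a - 1)) / m ^ 2 := by field_simp
      _ ≤ _ := by gcongr; exact le_max_right _ _

/-- Splitting the decay `|k|⁻²` of the covariance into a summable weight and a small remainder. -/
theorem inv_sq_le_freqWeight (k : ℤ × ℤ) :
    1 / (max 1 (max |(k.1 : ℝ)| |(k.2 : ℝ)|)) ^ 2
      ≤ (max 1 (max |(k.1 : ℝ)| |(k.2 : ℝ)|)) ^ (-(1 / 4) : ℝ) * freqWeight k ^ 3 := by
  set g := max 1 (max |(k.1 : ℝ)| |(k.2 : ℝ)|) with hg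
  set a := max 1 |(k.1 : ℝ)| with ha
  set b := max 1 |(k.2 : ℝ)| with hb
  have hg0 : 0 < g := lt_of_lt_of_le one_pos (le_max_left _ _)
  have ha0 : 0 < a := lt_of_lt_of_le one_pos (le_max_left _ _)
  have hb0 : 0 < b := lt_of_lt_of_le one_pos (le_max_left _ _)
  have hag : a ≤ g := max_le_max le_rfl (le_max_left _ _)
  have hbg : b ≤ g := max_le_max le_rfl (le_max_right _ _)
  have e : ∀ x : ℝ, 0 < x → (x ^ (-(7 / 24) : ℝ)) ^ 3 = x ^ (-(7 / 8) : ℝ) := by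
    intro x hx
    rw [← Real.rpow_natCast, ← Real.rpow_mul hx.le]
    norm_num
  have e2 : 1 / g ^ 2 = g ^ (-(1 / 4) : ℝ) * (g ^ (-(7 / 8) : ℝ) * g ^ (-(7 / 8) : ℝ)) := by
    rw [← Real.rpow_add hg0, ← Real.rpow_add hg0, one_div, ← Real.rpow_natCast,
      ← Real.rpow_neg hg0.le]
    norm_num
  rw [freqWeight, mul_pow, ← ha, ← hb, e a ha0, e b hb0, e2]
  have h1 := Real.rpow_le_rpow_of_nonpos ha0 hag (by norm_num : (-(7 / 8) : ℝ) ≤ 0)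
  have h2 := Real.rpow_le_rpow_of_nonpos hb0 hbg (by norm_num : (-(7 / 8) : ℝ) ≤ 0)
  gcongr

theorem inv_lam_prod_le {L : ℝ} {c : ℝ} (hc : 0 < c)
    (hlam : ∀ k : ℤ × ℤ, 1 / |lam L k| ≤ c / (max 1 (max |(k.1 : ℝ)| |(k.2 : ℝ)|)) ^ 2) (M : ℕ)
    {i j k l : ℤ × ℤ} (h : ¬ (i ∈ freqs M ∧ j ∈ freqs M ∧ k ∈ freqs M ∧ l ∈ freqs M)) :
    1 / |lam L i| * (1 / |lam L j|) * (1 / |lam L k|) * (1 / |lam L l|)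
      ≤ c ^ 4 * ((M + 1 : ℝ) ^ (-(1 / 4) : ℝ)) *
        (freqWeight i ^ 3 * freqWeight j ^ 3 * freqWeight k ^ 3 * freqWeight l ^ 3) := by
  set σ : ℤ × ℤ → ℝ := fun k => (max 1 (max |(k.1 : ℝ)| |(k.2 : ℝ)|)) ^ (-(1 / 4) : ℝ) with hσ
  have h0 : ∀ k, 0 ≤ σ k := fun k => by positivity
  have hle : ∀ k, 1 / |lam L k| ≤ c * (σ k * freqWeight k ^ 3) := fun k => by
    refine (hlam k).trans ?_
    rw [div_eq_mul_one_div]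
    exact mul_le_mul_of_nonneg_left (inv_sq_le_freqWeight k) hc.le
  have h1 : ∀ k, σ k ≤ 1 := fun k =>
    Real.rpow_le_one_of_one_le_of_nonpos (le_max_left _ _) (by norm_num)
  have hM : ∀ k : ℤ × ℤ, k ∉ freqs M → σ k ≤ (M + 1 : ℝ) ^ (-(1 / 4) : ℝ) := by
    intro k hk
    apply Real.rpow_le_rpow_of_nonpos (by positivity) _ (by norm_num)
    rw [mem_freqs, not_and_or, not_le, not_le] at hk
    rcases hk with hk | hk
    · have : ((M : ℤ) + 1 : ℤ) ≤ |k.1| := by omega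
      have h' : (M + 1 : ℝ) ≤ |(k.1 : ℝ)| := by exact_mod_cast this
      exact h'.trans ((le_max_left _ _).trans (le_max_right _ _))
    · have : ((M : ℤ) + 1 : ℤ) ≤ |k.2| := by omega
      have h' : (M + 1 : ℝ) ≤ |(k.2 : ℝ)| := by exact_mod_cast this
      exact h'.trans ((le_max_right _ _).trans (le_max_right _ _))
  have hw := fun k => pow_nonneg (freqWeight_nonneg k) 3
  have hσM : σ i * σ j * σ k * σ l ≤ (M + 1 : ℝ) ^ (-(1 / 4) : ℝ) := by
    have hij := mul_le_one₀ (h1 i) (h0 j) (h1 j)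
    have hijk := mul_le_one₀ hij (h0 k) (h1 k)
    have pij := mul_nonneg (h0 i) (h0 j)
    have pijk := mul_nonneg pij (h0 k)
    by_cases hi : i ∈ freqs M
    · by_cases hj : j ∈ freqs M
      · by_cases hk : k ∈ freqs M
        · have hl : l ∉ freqs M := fun hl => h ⟨hi, hj, hk, hl⟩
          exact (mul_le_of_le_one_left (h0 l) hijk).trans (hM l hl)
        · exact (mul_le_of_le_one_right pijk (h1 l)).trans
            ((mul_le_of_le_one_left (h0 k) hij).trans (hM k hk))
      · exact (mul_le_of_le_one_right pijk (h1 l)).trans ((mul_le_of_le_one_right pij (h1 k)).trans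
          ((mul_le_of_le_one_left (h0 j) (h1 i)).trans (hM j hj)))
    · exact (mul_le_of_le_one_right pijk (h1 l)).trans ((mul_le_of_le_one_right pij (h1 k)).trans
          ((mul_le_of_le_one_right (h0 i) (h1 j)).trans (hM i hi)))
  calc _ ≤ (c * (σ i * freqWeight i ^ 3)) * (c * (σ j * freqWeight j ^ 3))
        * (c * (σ k * freqWeight k ^ 3)) * (c * (σ l * freqWeight l ^ 3)) := by
        have p := fun k => mul_nonneg hc.le (mul_nonneg (h0 k) (hw k))
        have q : ∀ k, 0 ≤ 1 / |lam L k| := fun k => by positivity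
        refine mul_le_mul (mul_le_mul (mul_le_mul (hle i) (hle j) (q j) (p i)) (hle k) (q k) ?_)
          (hle l) (q l) ?_
        · exact mul_nonneg (p i) (p j)
        · exact mul_nonneg (mul_nonneg (p i) (p j)) (p k)
    _ = c ^ 4 * (σ i * σ j * σ k * σ l) *
        (freqWeight i ^ 3 * freqWeight j ^ 3 * freqWeight k ^ 3 * freqWeight l ^ 3) := by ring
    _ ≤ _ := by
        have := mul_nonneg (mul_nonneg (mul_nonneg (hw i) (hw j)) (hw k)) (hw l)
        gcongr

/-- The variance of the difference between the full renormalised quartic and its truncation at `M`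
is at most of order `(M + 1)^{-1/4}`, uniformly in `N`. -/
theorem exists_sum_fourth_deriv_le {L : ℝ} (hL0 : 0 < L) (hL : L < 2 * Real.pi) :
    ∃ c : ℝ, 0 < c ∧ ∀ N M : ℕ, ∑ i : Freq N, ∑ j : Freq N, ∑ k : Freq N, ∑ l : Freq N,
      1 / |lam L i.1| * (1 / |lam L j.1|) * (1 / |lam L k.1|) * (1 / |lam L l.1|) *
        (if i.1 ∈ freqs M ∧ j.1 ∈ freqs M ∧ k.1 ∈ freqs M ∧ l.1 ∈ freqs M then 0
          else 6 * torusIntegral L fun p =>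
            mode L i.1 p * mode L j.1 p * mode L k.1 p * mode L l.1 p) ^ 2
      ≤ c * (M + 1 : ℝ) ^ (-(1 / 4) : ℝ) := by
  obtain ⟨c, hc, hlam⟩ := inv_abs_lam_le hL0 hL
  set S := ∑' k : ℤ × ℤ, freqWeight k ^ 4 with hS
  have hSnn : 0 ≤ S := tsum_nonneg fun k => pow_nonneg (freqWeight_nonneg k) 4
  refine ⟨36 * (16 / L ^ 4) * c ^ 4 * (16 * (S ^ 3 + 1)), by positivity, fun N M => ?_⟩
  set A : ℝ := 36 * (16 / L ^ 4) * (c ^ 4 * (M + 1 : ℝ) ^ (-(1 / 4) : ℝ)) with hA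
  have hA0 : 0 ≤ A := by positivity
  set w : Freq N → ℝ := fun k => freqWeight k.1 with hw
  have hw0 : ∀ k, 0 ≤ w k := fun k => freqWeight_nonneg k.1
  -- the contribution of one choice of signs
  have hsign : ∀ a b c d : ℤˣ, ∑ i : Freq N, ∑ j : Freq N, ∑ k : Freq N, ∑ l : Freq N,
      (if (a : ℤ) • i.1 + (b : ℤ) • j.1 + (c : ℤ) • k.1 + (d : ℤ) • l.1 = 0
        then w i ^ 3 * w j ^ 3 * w k ^ 3 * w l ^ 3 else 0) ≤ S ^ 3 := by
    intro a b c d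
    have hinj : ∀ (s : ℤˣ) (x y : ℤ × ℤ), (s : ℤ) • x = (s : ℤ) • y → x = y := by
      intro s x y hxy
      rcases Int.units_eq_one_or s with rfl | rfl <;> simpa using hxy
    refine (sum_four_constrained_le (t := w) (fun i j k l => (a : ℤ) • i.1 + (b : ℤ) • j.1
      + (c : ℤ) • k.1 + (d : ℤ) • l.1 = 0) ?_ ?_ ?_ ?_).trans ?_
    · intro i i' j k l h h'
      refine Subtype.ext (hinj a _ _ ?_)
      have := h.trans h'.symm
      simpa using this
    · intro i j j' k l h h'
      refine Subtype.ext (hinj b _ _ ?_)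
      have := h.trans h'.symm
      simpa using this
    · intro i j k k' l h h'
      refine Subtype.ext (hinj c _ _ ?_)
      have := h.trans h'.symm
      simpa using this
    · intro i j k l l' h h'
      refine Subtype.ext (hinj d _ _ ?_)
      have := h.trans h'.symm
      simpa using this
    · have hle : ∑ k : Freq N, w k ^ 4 ≤ S := by
        rw [Finset.univ_eq_attach, Finset.sum_attach (freqs N) (fun k => freqWeight k ^ 4)]
        exact summable_freqWeight.sum_le_tsum _ fun k _ => pow_nonneg (freqWeight_nonneg k) 4
      have : 0 ≤ ∑ k : Freq N, w k ^ 4 := Finset.sum_nonneg fun k _ => pow_nonneg (hw0 k) 4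
      gcongr
  have hpt : ∀ i j k l : Freq N,
      1 / |lam L i.1| * (1 / |lam L j.1|) * (1 / |lam L k.1|) * (1 / |lam L l.1|) *
        (if i.1 ∈ freqs M ∧ j.1 ∈ freqs M ∧ k.1 ∈ freqs M ∧ l.1 ∈ freqs M then 0
          else 6 * torusIntegral L fun p =>
            mode L i.1 p * mode L j.1 p * mode L k.1 p * mode L l.1 p) ^ 2
      ≤ A * ∑ a : ℤˣ, ∑ b : ℤˣ, ∑ c : ℤˣ, ∑ d : ℤˣ,
        (if (a : ℤ) • i.1 + (b : ℤ) • j.1 + (c : ℤ) • k.1 + (d : ℤ) • l.1 = 0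
        then w i ^ 3 * w j ^ 3 * w k ^ 3 * w l ^ 3 else 0) := by
    intro i j k l
    have hW : 0 ≤ w i ^ 3 * w j ^ 3 * w k ^ 3 * w l ^ 3 :=
      mul_nonneg (mul_nonneg (mul_nonneg (pow_nonneg (hw0 i) 3) (pow_nonneg (hw0 j) 3))
        (pow_nonneg (hw0 k) 3)) (pow_nonneg (hw0 l) 3)
    split_ifs with hM
    · rw [zero_pow two_ne_zero, mul_zero]
      refine mul_nonneg hA0 (Finset.sum_nonneg fun a _ => Finset.sum_nonneg fun b _ =>
        Finset.sum_nonneg fun c _ => Finset.sum_nonneg fun d _ => ?_)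
      split_ifs
      exacts [hW, le_rfl]
    · have h1 := inv_lam_prod_le hc hlam M hM
      have h2 := sq_integral_four_modes_le hL0 i.1 j.1 k.1 l.1
      set R : ℝ := ∑ a : ℤˣ, ∑ b : ℤˣ, ∑ c : ℤˣ, ∑ d : ℤˣ,
        if (a : ℤ) • i.1 + (b : ℤ) • j.1 + (c : ℤ) • k.1 + (d : ℤ) • l.1 = 0 then 1 else 0 with hR
      have h3 : ∑ a : ℤˣ, ∑ b : ℤˣ, ∑ c : ℤˣ, ∑ d : ℤˣ,
          (if (a : ℤ) • i.1 + (b : ℤ) • j.1 + (c : ℤ) • k.1 + (d : ℤ) • l.1 = 0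
          then w i ^ 3 * w j ^ 3 * w k ^ 3 * w l ^ 3 else 0)
          = (w i ^ 3 * w j ^ 3 * w k ^ 3 * w l ^ 3) * R := by
        rw [hR]
        simp only [Finset.mul_sum, mul_ite, mul_one, mul_zero]
      rw [h3, mul_pow]
      clear_value R
      refine (mul_le_mul h1 (mul_le_mul_of_nonneg_left h2 (by norm_num)) (by positivity)
        (mul_nonneg (by positivity) hW)).trans (le_of_eq ?_)
      rw [hA]
      ring
  have hswap : ∑ i : Freq N, ∑ j : Freq N, ∑ k : Freq N, ∑ l : Freq N,
      ∑ a : ℤˣ, ∑ b : ℤˣ, ∑ c : ℤˣ, ∑ d : ℤˣ,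
        (if (a : ℤ) • i.1 + (b : ℤ) • j.1 + (c : ℤ) • k.1 + (d : ℤ) • l.1 = 0
        then w i ^ 3 * w j ^ 3 * w k ^ 3 * w l ^ 3 else 0)
      = ∑ s : ℤˣ × ℤˣ × ℤˣ × ℤˣ, ∑ i : Freq N, ∑ j : Freq N, ∑ k : Freq N, ∑ l : Freq N,
        (if (s.1 : ℤ) • i.1 + (s.2.1 : ℤ) • j.1 + (s.2.2.1 : ℤ) • k.1 + (s.2.2.2 : ℤ) • l.1 = 0
        then w i ^ 3 * w j ^ 3 * w k ^ 3 * w l ^ 3 else 0) := by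
    symm
    rw [Finset.sum_comm]
    refine Finset.sum_congr rfl fun i _ => ?_
    rw [Finset.sum_comm]
    refine Finset.sum_congr rfl fun j _ => ?_
    rw [Finset.sum_comm]
    refine Finset.sum_congr rfl fun k _ => ?_
    rw [Finset.sum_comm]
    refine Finset.sum_congr rfl fun l _ => ?_
    simp only [Fintype.sum_prod_type]
  calc _ ≤ ∑ i : Freq N, ∑ j : Freq N, ∑ k : Freq N, ∑ l : Freq N,
        A * ∑ a : ℤˣ, ∑ b : ℤˣ, ∑ c : ℤˣ, ∑ d : ℤˣ,
        (if (a : ℤ) • i.1 + (b : ℤ) • j.1 + (c : ℤ) • k.1 + (d : ℤ) • l.1 = 0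
        then w i ^ 3 * w j ^ 3 * w k ^ 3 * w l ^ 3 else 0) :=
        Finset.sum_le_sum fun i _ => Finset.sum_le_sum fun j _ => Finset.sum_le_sum fun k _ =>
          Finset.sum_le_sum fun l _ => hpt i j k l
    _ ≤ A * (16 * S ^ 3) := by
        simp only [← Finset.mul_sum]
        refine mul_le_mul_of_nonneg_left ?_ hA0
        rw [hswap]
        refine (Finset.sum_le_card_nsmul _ _ (S ^ 3) fun s _ => hsign _ _ _ _).trans (le_of_eq ?_)
        rw [nsmul_eq_mul, Finset.card_univ]
        simp only [Fintype.card_prod, Fintype.card_units_int]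
        norm_num
    _ ≤ A * (16 * (S ^ 3 + 1)) := by gcongr; linarith
    _ = _ := by rw [hA]; ring

/-! ### Nelson's estimate -/

theorem card_freqs (N : ℕ) : (freqs N).card = (2 * N + 1) ^ 2 := by
  rw [freqs, Finset.card_product, Int.card_Icc, sq]
  congr 1 <;> omega

/-- The renormalisation constant diverges logarithmically: each dyadic shell contributes a bounded
amount. -/
theorem exists_renormConst_two_pow_le {L : ℝ} (hL0 : 0 < L) (hL : L < 2 * Real.pi) :
    ∃ c : ℝ, 0 < c ∧ ∀ j : ℕ, renormConst L (2 ^ j) ≤ c * (j + 1) := by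
  obtain ⟨c, hc, hlam⟩ := inv_abs_lam_le hL0 hL
  have hnn : ∀ K, 0 ≤ renormConst L K := fun K =>
    mul_nonneg (by positivity) (Finset.sum_nonneg fun k _ => by positivity)
  have hstep : ∀ j : ℕ, renormConst L (2 ^ (j + 1)) ≤ renormConst L (2 ^ j) + 25 * c / L ^ 2 := by
    intro j
    have hsub : freqs (2 ^ j) ⊆ freqs (2 ^ (j + 1)) :=
      freqs_mono (Nat.pow_le_pow_right (by norm_num) (Nat.le_succ j))
    have hshell : ∑ k ∈ freqs (2 ^ (j + 1)) \ freqs (2 ^ j), 1 / |lam L k| ≤ 25 * c := by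
      have h1 : ∀ k ∈ freqs (2 ^ (j + 1)) \ freqs (2 ^ j), 1 / |lam L k| ≤ c / (2 ^ j) ^ 2 := by
        intro k hk
        refine (hlam k).trans ?_
        have hk2 := (Finset.mem_sdiff.1 hk).2
        rw [mem_freqs, not_and_or, not_le, not_le] at hk2
        have : (2 ^ j : ℝ) ≤ max 1 (max |(k.1 : ℝ)| |(k.2 : ℝ)|) := by
          rcases hk2 with h | h
          · have h' : (2 ^ j : ℝ) < |(k.1 : ℝ)| := by exact_mod_cast h
            exact h'.le.trans ((le_max_left _ _).trans (le_max_right _ _))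
          · have h' : (2 ^ j : ℝ) < |(k.2 : ℝ)| := by exact_mod_cast h
            exact h'.le.trans ((le_max_right _ _).trans (le_max_right _ _))
        gcongr
      have hcard : ((freqs (2 ^ (j + 1)) \ freqs (2 ^ j)).card : ℝ) ≤ 25 * (2 ^ j) ^ 2 := by
        have h2 : (freqs (2 ^ (j + 1)) \ freqs (2 ^ j)).card ≤ (2 * 2 ^ (j + 1) + 1) ^ 2 := by
          rw [← card_freqs]; exact Finset.card_le_card Finset.sdiff_subset
        have h3 : 1 ≤ 2 ^ j := Nat.one_le_two_pow
        have h4 : (2 * 2 ^ (j + 1) + 1) ^ 2 ≤ 25 * (2 ^ j) ^ 2 := by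
          calc (2 * 2 ^ (j + 1) + 1) ^ 2 ≤ (5 * 2 ^ j) ^ 2 :=
                Nat.pow_le_pow_left (by rw [pow_succ]; omega) 2
            _ = _ := by ring
        exact_mod_cast h2.trans h4
      refine (Finset.sum_le_card_nsmul _ _ _ h1).trans ?_
      rw [nsmul_eq_mul]
      refine (mul_le_mul_of_nonneg_right hcard (by positivity)).trans (le_of_eq ?_)
      field_simp
    rw [renormConst, renormConst, ← Finset.sum_sdiff hsub, mul_add, add_comm]
    have : 1 / L ^ 2 * ∑ k ∈ freqs (2 ^ (j + 1)) \ freqs (2 ^ j), 1 / |lam L k|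
        ≤ 1 / L ^ 2 * (25 * c) := by gcongr
    have e : 1 / L ^ 2 * (25 * c) = 25 * c / L ^ 2 := by ring
    linarith
  refine ⟨renormConst L 1 + 25 * c / L ^ 2, add_pos_of_nonneg_of_pos (hnn 1) (by positivity),
    fun j => ?_⟩
  have hpos : 0 < 25 * c / L ^ 2 := by positivity
  induction j with
  | zero => simp; linarith
  | succ j ih =>
    have := hstep j
    have := hnn 1
    push_cast
    nlinarith

/-- If `-w` exceeds the threshold `a j` but not `a (j + 1)`, then `w` differs from its `j`-th
approximation by at least one, and the `j`-th summand takes over. -/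
theorem exp_neg_le_sum {w : ℝ} {W a : ℕ → ℝ} (hW : ∀ j, 1 - a j ≤ W j) (q : ℕ → ℕ) (J : ℕ)
    (hJ : -w ≤ a J) :
    Real.exp (-w) ≤ Real.exp (a 0)
      + ∑ j ∈ Finset.range J, Real.exp (a (j + 1)) * (w - W j) ^ (2 * (q j + 1)) := by
  have hnn : ∀ j, 0 ≤ Real.exp (a (j + 1)) * (w - W j) ^ (2 * (q j + 1)) := fun j => by
    rw [pow_mul]; positivity
  induction J with
  | zero => simpa using hJ
  | succ J ih =>
    rw [Finset.sum_range_succ]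
    by_cases h : -w ≤ a J
    · have := ih h
      have := hnn J
      linarith
    · have h1 : 1 ≤ (w - W J) ^ 2 := by nlinarith [hW J]
      have h2 : 1 ≤ (w - W J) ^ (2 * (q J + 1)) := by
        rw [pow_mul]; exact one_le_pow₀ h1
      have h3 : Real.exp (-w) ≤ Real.exp (a (J + 1)) := Real.exp_le_exp.2 hJ
      have h4 := le_mul_of_one_le_right (Real.exp_pos (a (J + 1))).le h2
      have h5 := Finset.sum_nonneg fun j (_ : j ∈ Finset.range J) => hnn j
      have h6 := Real.exp_pos (a 0)
      linarith

section

variable {L : ℝ} {N : ℕ}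

@[fun_prop]
theorem continuous_eval (p : MvPolynomial (Freq N) ℝ) :
    Continuous fun y : State N => MvPolynomial.eval y.ofLp p :=
  (MvPolynomial.continuous_eval p).comp (PiLp.continuous_ofLp 2 _)

theorem continuous_wick (L : ℝ) : Continuous fun y : State N => wick L y := by
  simp only [← eval_wickTrunc_self]
  exact continuous_eval _

theorem wick_ge (hL : 0 ≤ L) (y : State N) :
    -(3 / 2 * L ^ 2 * renormConst L N ^ 2) ≤ wick L y := by
  rw [← eval_wickTrunc_self]
  exact eval_wickTrunc_ge hL N N _

variable (hL0 : 0 < L) (hL : L < 2 * Real.pi)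
include hL0 hL

theorem integrable_exp_neg_mul_wick {ε : ℝ} (hε : 0 ≤ ε) :
    Integrable (fun y : State N => Real.exp (-ε * wick L y)) (gauss L N) := by
  have := isProbabilityMeasure_gauss (N := N) hL0 hL
  refine Integrable.of_bound (C := Real.exp (ε * (3 / 2 * L ^ 2 * renormConst L N ^ 2)))
    (Real.continuous_exp.comp
      (continuous_const.mul (continuous_wick L))).aestronglyMeasurable
    (Filter.Eventually.of_forall fun y => ?_)
  rw [Real.norm_of_nonneg (Real.exp_pos _).le]
  have := mul_le_mul_of_nonneg_left (wick_ge hL0.le y) hε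
  exact Real.exp_le_exp.2 (by linarith)

theorem integral_wick : ∫ y : State N, wick L y ∂(gauss L N) = 0 := by
  have h := (isGaussianExpectation_gauss (N := N) hL0 hL).eq_zero_of_mem_chaos (n := 3)
    (wickTrunc_mem_chaos L N N)
  rw [gaussExpectation_apply] at h
  simpa only [eval_wickTrunc_self] using h

theorem integrable_wick : Integrable (fun y : State N => wick L y) (gauss L N) := by
  simp only [← eval_wickTrunc_self]
  exact integrable_eval_gauss hL0 hL _

/-- Hypercontractivity for the truncation error. -/
theorem exists_moment_sub_wickTrunc_le : ∃ c : ℝ, 0 < c ∧ ∀ N M q : ℕ,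
    ∫ y, (MvPolynomial.eval y.ofLp (wickTrunc L N N) - MvPolynomial.eval y.ofLp (wickTrunc L N M))
        ^ (2 * (q + 1)) ∂(gauss L N)
      ≤ ((2 * q + 1) ^ 4 * (c * (M + 1 : ℝ) ^ (-(1 / 4) : ℝ))) ^ (q + 1) := by
  obtain ⟨c, hc, hK⟩ := exists_sum_fourth_deriv_le hL0 hL
  refine ⟨c, hc, fun N M q => ?_⟩
  have h := (isGaussianExpectation_gauss (N := N) hL0 hL).chaos_four_moment_le
    (fun k => by positivity) (Submodule.sub_mem _ (wickTrunc_mem_chaos L N N)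
      (wickTrunc_mem_chaos L N M)) (pderiv_four_sub_wickTrunc L N M) q
  rw [gaussExpectation_apply] at h
  simp only [map_pow, map_sub] at h
  refine h.trans ?_
  have hK' := hK N M
  have hnn : 0 ≤ ∑ i : Freq N, ∑ j : Freq N, ∑ k : Freq N, ∑ l : Freq N,
      1 / |lam L i.1| * (1 / |lam L j.1|) * (1 / |lam L k.1|) * (1 / |lam L l.1|) *
        (if i.1 ∈ freqs M ∧ j.1 ∈ freqs M ∧ k.1 ∈ freqs M ∧ l.1 ∈ freqs M then 0
          else 6 * torusIntegral L fun p =>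
            mode L i.1 p * mode L j.1 p * mode L k.1 p * mode L l.1 p) ^ 2 :=
    Finset.sum_nonneg fun i _ => Finset.sum_nonneg fun j _ => Finset.sum_nonneg fun k _ =>
      Finset.sum_nonneg fun l _ => by positivity
  have h24 : ((2 * q + 1 : ℝ) ^ 4 / 24) ≤ (2 * q + 1 : ℝ) ^ 4 :=
    div_le_self (by positivity) (by norm_num)
  refine pow_le_pow_left₀ (mul_nonneg (by positivity) hnn) ?_ _
  exact mul_le_mul h24 hK' hnn (by positivity)

omit hL0 hL in
/-- Super-exponential gain: moments of order proportional to `j` beat the Gaussian growth of the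
thresholds as soon as the proportionality constant is large. -/
theorem exists_summable_dyadic (A c : ℝ) (hA : 0 ≤ A) (hc : 0 < c) : ∃ q : ℕ → ℕ,
    Summable fun j : ℕ => Real.exp (A * ((j + 1 : ℕ) + 1) ^ 2 + 1) *
      ((2 * q j + 1) ^ 4 * (c * ((2 ^ j : ℕ) + 1 : ℝ) ^ (-(1 / 4) : ℝ))) ^ (q j + 1) := by
  set θ : ℝ := (2 : ℝ) ^ (-(1 / 4) : ℝ) with hθ
  have hθ0 : 0 < θ := by positivity
  have hθ1 : θ < 1 := Real.rpow_lt_one_of_one_lt_of_neg (by norm_num) (by norm_num)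
  -- the moment order is `b (j + 1)`, where `θ ^ b` beats the growth rate `e^{4A}`
  obtain ⟨B, hB⟩ : ∃ B : ℕ, θ ^ (B + 1) * Real.exp (4 * A) < 1 := by
    obtain ⟨n, hn⟩ := exists_pow_lt_of_lt_one (Real.exp_pos (-(4 * A))) hθ1
    refine ⟨n, ?_⟩
    have h1 : θ ^ (n + 1) < Real.exp (-(4 * A)) :=
      (pow_le_pow_of_le_one hθ0.le hθ1.le (Nat.le_succ n)).trans_lt hn
    have := mul_lt_mul_of_pos_right h1 (Real.exp_pos (4 * A))
    rwa [← Real.exp_add, neg_add_cancel, Real.exp_zero] at this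
  set b := B + 1 with hb
  have hb0 : (0 : ℝ) < b := by rw [hb]; positivity
  set ρ := θ ^ b * Real.exp (4 * A) with hρ
  have hρ0 : 0 < ρ := by positivity
  set r : ℕ → ℝ := fun j => ((2 * b) ^ 4 * c / θ) ^ b * (((j + 1 : ℕ) : ℝ) ^ (4 * b) * ρ ^ (j + 1))
    with hr
  have hr0 : ∀ j, 0 ≤ r j := fun j => by positivity
  have hlim : Filter.Tendsto r Filter.atTop (nhds 0) := by
    have h1 := (tendsto_pow_const_mul_const_pow_of_abs_lt_one (4 * b)
      (show |ρ| < 1 by rwa [abs_of_pos hρ0])).comp (Filter.tendsto_add_atTop_nat 1)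
    have h2 := h1.const_mul (((2 * b) ^ 4 * c / θ) ^ b)
    rw [mul_zero] at h2
    exact h2
  refine ⟨fun j => b * (j + 1) - 1, ?_⟩
  have hq : ∀ j : ℕ, b * (j + 1) - 1 + 1 = b * (j + 1) := fun j =>
    Nat.sub_add_cancel (Nat.mul_pos (Nat.succ_pos B) (Nat.succ_pos j))
  have hterm : ∀ j : ℕ, Real.exp (A * ((j + 1 : ℕ) + 1) ^ 2 + 1) *
      ((2 * ((b * (j + 1) - 1 : ℕ) : ℝ) + 1) ^ 4 *
        (c * ((2 ^ j : ℕ) + 1 : ℝ) ^ (-(1 / 4) : ℝ))) ^ (b * (j + 1) - 1 + 1)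
      ≤ Real.exp 1 * r j ^ (j + 1) := by
    intro j
    rw [hq j]
    have h1 : (2 * ((b * (j + 1) - 1 : ℕ) : ℝ) + 1) ≤ 2 * b * (j + 1 : ℕ) := by
      have : ((b * (j + 1) - 1 : ℕ) : ℝ) + 1 = b * (j + 1 : ℕ) := by exact_mod_cast hq j
      linarith
    have h2 : ((2 ^ j : ℕ) + 1 : ℝ) ^ (-(1 / 4) : ℝ) ≤ θ ^ j := by
      have e : θ ^ j = ((2 : ℝ) ^ j) ^ (-(1 / 4) : ℝ) := by
        rw [hθ, ← Real.rpow_natCast, ← Real.rpow_natCast, ← Real.rpow_mul (by norm_num),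
          ← Real.rpow_mul (by norm_num), mul_comm]
      rw [e]
      apply Real.rpow_le_rpow_of_nonpos (by positivity) _ (by norm_num)
      push_cast; linarith
    have h3 : A * ((j + 1 : ℕ) + 1 : ℝ) ^ 2 ≤ 4 * A * (j + 1 : ℕ) * (j + 1 : ℕ) := by
      have : ((j + 1 : ℕ) + 1 : ℝ) ^ 2 ≤ 4 * ((j + 1 : ℕ) * (j + 1 : ℕ)) := by
        push_cast; nlinarith [(Nat.cast_nonneg j : (0 : ℝ) ≤ j)]
      nlinarith
    have h4 : Real.exp (A * ((j + 1 : ℕ) + 1) ^ 2 + 1)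
        ≤ Real.exp 1 * ((Real.exp (4 * A)) ^ (j + 1)) ^ (j + 1) := by
      rw [← Real.exp_nat_mul, ← Real.exp_nat_mul, ← Real.exp_add]
      apply Real.exp_le_exp.2
      linarith
    have h5 : ((2 * ((b * (j + 1) - 1 : ℕ) : ℝ) + 1) ^ 4 *
        (c * ((2 ^ j : ℕ) + 1 : ℝ) ^ (-(1 / 4) : ℝ))) ^ (b * (j + 1))
        ≤ (((2 * b * (j + 1 : ℕ)) ^ 4 * (c * θ ^ j)) ^ b) ^ (j + 1) := by
      rw [← pow_mul]
      gcongr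
    calc _ ≤ (Real.exp 1 * ((Real.exp (4 * A)) ^ (j + 1)) ^ (j + 1)) *
          (((2 * b * (j + 1 : ℕ)) ^ 4 * (c * θ ^ j)) ^ b) ^ (j + 1) := by gcongr
      _ = Real.exp 1 * ((Real.exp (4 * A)) ^ (j + 1) *
          ((2 * b * (j + 1 : ℕ)) ^ 4 * (c * θ ^ j)) ^ b) ^ (j + 1) := by rw [mul_pow]; ring
      _ = _ := by
        congr 2
        have e1 : (2 * b * (j + 1 : ℕ) : ℝ) ^ 4 * (c * θ ^ j)
            = ((2 * b) ^ 4 * c / θ) * ((j + 1 : ℕ) ^ 4 * θ ^ (j + 1)) := by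
          rw [pow_succ θ j]
          field_simp
        rw [e1, hr, hρ]
        simp only [mul_pow]
        rw [← pow_mul, ← pow_mul θ, ← pow_mul θ, mul_comm b (j + 1)]
        ring
  have hev : ∀ᶠ j in Filter.atTop, r j ≤ 1 / 2 := hlim.eventually_le_const (by norm_num)
  have hgeo : Summable fun j : ℕ => Real.exp 1 * (1 / 2 : ℝ) ^ (j + 1) :=
    ((summable_nat_add_iff 1).2 summable_geometric_two).mul_left _
  refine hgeo.of_norm_bounded_eventually_nat ?_
  filter_upwards [hev] with j hj
  rw [Real.norm_of_nonneg (by positivity)]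
  refine (hterm j).trans ?_
  have := hr0 j
  gcongr

/-- Nelson's estimate: the partition functions are bounded uniformly in the cutoff. -/
theorem exists_integral_exp_neg_wick_le : ∃ C : ℝ, 0 ≤ C ∧ ∀ N : ℕ,
    ∫ y : State N, Real.exp (-wick L y) ∂(gauss L N) ≤ C := by
  obtain ⟨c₁, hc₁, hren⟩ := exists_renormConst_two_pow_le hL0 hL
  obtain ⟨c, hc, hmom⟩ := exists_moment_sub_wickTrunc_le hL0 hL
  set A := 3 / 2 * L ^ 2 * c₁ ^ 2 with hA
  have hA0 : 0 ≤ A := by positivity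
  obtain ⟨q, hq⟩ := exists_summable_dyadic A c hA0 hc
  set a : ℕ → ℝ := fun j => A * ((j : ℝ) + 1) ^ 2 + 1 with ha
  set τ : ℕ → ℝ := fun j : ℕ => Real.exp (A * ((j + 1 : ℕ) + 1) ^ 2 + 1) *
      ((2 * q j + 1) ^ 4 * (c * ((2 ^ j : ℕ) + 1 : ℝ) ^ (-(1 / 4) : ℝ))) ^ (q j + 1) with hτ
  have hτ0 : ∀ j, 0 ≤ τ j := fun j => by positivity
  refine ⟨Real.exp (a 0) + ∑' j, τ j, add_nonneg (Real.exp_pos _).le (tsum_nonneg hτ0),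
    fun N => ?_⟩
  have hprob := isProbabilityMeasure_gauss (N := N) hL0 hL
  set W : ℕ → State N → ℝ := fun j y => MvPolynomial.eval y.ofLp (wickTrunc L N (2 ^ j)) with hW
  have hWge : ∀ j y, 1 - a j ≤ W j y := by
    intro j y
    have h1 := eval_wickTrunc_ge hL0.le N (2 ^ j) y.ofLp
    have h0 : 0 ≤ renormConst L (2 ^ j) :=
      mul_nonneg (by positivity) (Finset.sum_nonneg fun k _ => by positivity)
    have h2 : renormConst L (2 ^ j) ^ 2 ≤ (c₁ * (j + 1)) ^ 2 := by
      have := hren j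
      gcongr
    have h3 := mul_le_mul_of_nonneg_left h2 (by positivity : 0 ≤ 3 / 2 * L ^ 2)
    have h4 : 3 / 2 * L ^ 2 * (c₁ * ((j : ℝ) + 1)) ^ 2 = A * ((j : ℝ) + 1) ^ 2 := by rw [hA]; ring
    simp only [ha, hW]
    linarith
  obtain ⟨J, hJ⟩ : ∃ J : ℕ, N ≤ 2 ^ J := ⟨N, Nat.lt_two_pow_self.le⟩
  have hpt : ∀ y : State N, Real.exp (-wick L y) ≤ Real.exp (a 0) + ∑ j ∈ Finset.range J,
      Real.exp (a (j + 1)) * (MvPolynomial.eval y.ofLp (wickTrunc L N N) - W j y)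
        ^ (2 * (q j + 1)) := by
    intro y
    rw [← eval_wickTrunc_self]
    refine exp_neg_le_sum (W := fun j => W j y) (fun j => hWge j y) q J ?_
    have := hWge J y
    simp only [hW] at this
    rw [wickTrunc_eq_of_le L hJ] at this
    linarith
  have hint : ∀ j, Integrable (fun y : State N => Real.exp (a (j + 1)) *
      (MvPolynomial.eval y.ofLp (wickTrunc L N N) - W j y) ^ (2 * (q j + 1))) (gauss L N) := by
    intro j
    have := integrable_eval_gauss hL0 hL
      ((wickTrunc L N N - wickTrunc L N (2 ^ j)) ^ (2 * (q j + 1)))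
    simp only [map_pow, map_sub] at this
    exact this.const_mul _
  have h1 : ∫ y : State N, Real.exp (-wick L y) ∂(gauss L N) ≤
      ∫ y : State N, (Real.exp (a 0) + ∑ j ∈ Finset.range J,
      Real.exp (a (j + 1)) * (MvPolynomial.eval y.ofLp (wickTrunc L N N) - W j y)
        ^ (2 * (q j + 1))) ∂(gauss L N) := by
    refine integral_mono ?_ ?_ hpt
    · have := integrable_exp_neg_mul_wick (N := N) hL0 hL zero_le_one
      simpa using this
    · exact (integrable_const _).add (integrable_finsetSum _ fun j _ => hint j)
  refine h1.trans ?_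
  rw [integral_add (integrable_const _) (integrable_finsetSum _ fun j _ => hint j),
    integral_finsetSum _ fun j _ => hint j, integral_const, probReal_univ, one_smul]
  refine add_le_add le_rfl ?_
  refine le_trans (Finset.sum_le_sum fun j _ => ?_)
    (hq.sum_le_tsum (Finset.range J) fun j _ => hτ0 j)
  rw [integral_const_mul]
  exact mul_le_mul_of_nonneg_left (hmom N (2 ^ j) (q j)) (Real.exp_pos _).le

/-- Convexity in `ε` reduces the expansion to the bound at `ε = 1`; the first-order term vanishes
because `wick` has mean zero. -/
theorem exists_integral_exp_neg_mul_wick :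
    ∃ C : ℝ, 0 ≤ C ∧ ∀ N : ℕ, ∀ ε : ℝ, 0 < ε → ε < 1 →
      Integrable (fun y : State N => Real.exp (-ε * wick L y)) (gauss L N) ∧
        |∫ y, Real.exp (-ε * wick L y) ∂(gauss L N) - 1| ≤ C * ε := by
  obtain ⟨C, hC0, hC⟩ := exists_integral_exp_neg_wick_le hL0 hL
  refine ⟨C, hC0, fun N ε hε0 hε1 => ?_⟩
  have hprob := isProbabilityMeasure_gauss (N := N) hL0 hL
  have hint := integrable_exp_neg_mul_wick (N := N) hL0 hL hε0.le
  have hint1 : Integrable (fun y : State N => Real.exp (-wick L y)) (gauss L N) := by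
    simpa using integrable_exp_neg_mul_wick (N := N) hL0 hL zero_le_one
  refine ⟨hint, ?_⟩
  have hlow : 1 ≤ ∫ y : State N, Real.exp (-ε * wick L y) ∂(gauss L N) := by
    have h1 : ∫ y : State N, (1 + -ε * wick L y) ∂(gauss L N) = 1 := by
      rw [integral_add (integrable_const _) ((integrable_wick hL0 hL).const_mul _),
        integral_const_mul, integral_wick hL0 hL]
      simp
    rw [← h1]
    refine integral_mono ((integrable_const _).add ((integrable_wick hL0 hL).const_mul _)) hint
      fun y => ?_
    have := Real.add_one_le_exp (-ε * wick L y)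
    beta_reduce
    linarith
  have hup : ∫ y : State N, Real.exp (-ε * wick L y) ∂(gauss L N) ≤ 1 + C * ε := by
    have h1 : ∫ y : State N, ((1 - ε) + ε * Real.exp (-wick L y)) ∂(gauss L N)
        ≤ 1 + C * ε := by
      rw [integral_add (integrable_const _) (hint1.const_mul _), integral_const_mul]
      have := mul_le_mul_of_nonneg_left (hC N) hε0.le
      simp only [integral_const, probReal_univ, one_smul]
      linarith
    refine le_trans (integral_mono hint ((integrable_const _).add (hint1.const_mul _))
      fun y => ?_) h1
    have := convexOn_exp.2 (Set.mem_univ (-wick L y)) (Set.mem_univ 0) hε0.le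
      (sub_nonneg.2 hε1.le) (by ring)
    simp only [smul_eq_mul, mul_zero, add_zero, Real.exp_zero, mul_one] at this
    rw [neg_mul_comm]
    simp only [Pi.add_apply]
    linarith
  rw [abs_le]
  constructor
  · have := mul_nonneg hC0 hε0.le
    linarith
  · linarith

end

/-! ### The one-dimensional transition profile -/

/-- The Gaussian weight `e^{-t²/2ε}`, multiplied by a cutoff that vanishes outside `[-a, a]`. -/
def cutGauss (a ε t : ℝ) : ℝ := Real.exp (-(1 / (2 * ε)) * t ^ 2) * max 0 (1 - t ^ 2 / a ^ 2)

/-- The mass of `cutGauss`. -/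
def cutMass (a ε : ℝ) : ℝ := ∫ s in (-a)..a, cutGauss a ε s

/-- The normalised primitive of `-cutGauss`, which decreases from `1` to `0` across `[-a, a]`. -/
def profile (a ε t : ℝ) : ℝ := 1 - (∫ s in (-a)..t, cutGauss a ε s) / cutMass a ε

@[fun_prop]
theorem continuous_cutGauss (a ε : ℝ) : Continuous (cutGauss a ε) := by
  unfold cutGauss; fun_prop

theorem cutGauss_nonneg (a ε t : ℝ) : 0 ≤ cutGauss a ε t :=
  mul_nonneg (Real.exp_pos _).le (le_max_left _ _)

theorem cutGauss_le (a ε t : ℝ) : cutGauss a ε t ≤ Real.exp (-(1 / (2 * ε)) * t ^ 2) := by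
  refine mul_le_of_le_one_right (Real.exp_pos _).le (max_le zero_le_one ?_)
  have : 0 ≤ t ^ 2 / a ^ 2 := by positivity
  linarith

theorem cutGauss_eq_zero {a ε t : ℝ} (ha : 0 < a) (ht : a ≤ |t|) : cutGauss a ε t = 0 := by
  have : 1 ≤ t ^ 2 / a ^ 2 := by
    rw [one_le_div (by positivity), ← sq_abs t]
    gcongr
  rw [cutGauss, max_eq_left (by linarith), mul_zero]

theorem hasDerivAt_profile (a ε t : ℝ) :
    HasDerivAt (profile a ε) (-(cutGauss a ε t / cutMass a ε)) t := by
  have h := intervalIntegral.integral_hasDerivAt_right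
    ((continuous_cutGauss a ε).intervalIntegrable (-a) t)
    (continuous_cutGauss a ε).stronglyMeasurable.stronglyMeasurableAtFilter
    (continuous_cutGauss a ε).continuousAt
  exact ((h.div_const (cutMass a ε)).const_sub 1)

theorem profile_of_le {a ε t : ℝ} (ha : 0 < a) (ht : t ≤ -a) : profile a ε t = 1 := by
  have : ∫ s in (-a)..t, cutGauss a ε s = 0 := by
    rw [intervalIntegral.integral_congr (g := fun _ => 0), intervalIntegral.integral_zero]
    intro s hs
    rw [Set.uIcc_of_ge ht] at hs
    exact cutGauss_eq_zero ha (by rw [abs_of_nonpos (by linarith [hs.2])]; linarith [hs.2])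
  rw [profile, this]; simp

theorem profile_of_ge {a ε t : ℝ} (ha : 0 < a) (hm : cutMass a ε ≠ 0) (ht : a ≤ t) :
    profile a ε t = 0 := by
  have h1 : ∫ s in a..t, cutGauss a ε s = 0 := by
    rw [intervalIntegral.integral_congr (g := fun _ => 0), intervalIntegral.integral_zero]
    intro s hs
    rw [Set.uIcc_of_le ht] at hs
    exact cutGauss_eq_zero ha (by rw [abs_of_nonneg (by linarith [hs.1])]; linarith [hs.1])
  have h2 := intervalIntegral.integral_add_adjacent_intervals
    ((continuous_cutGauss a ε).intervalIntegrable (μ := volume) (-a) a)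
    ((continuous_cutGauss a ε).intervalIntegrable (μ := volume) a t)
  rw [profile, ← h2, h1, add_zero, ← cutMass, div_self hm, sub_self]

theorem cutMass_eq_integral {a : ℝ} (ha : 0 < a) (ε : ℝ) :
    cutMass a ε = ∫ t, cutGauss a ε t := by
  rw [cutMass, intervalIntegral.integral_of_le (by linarith)]
  refine setIntegral_eq_integral_of_forall_compl_eq_zero fun t ht => cutGauss_eq_zero ha ?_
  rw [Set.mem_Ioc, not_and_or, not_lt, not_le] at ht
  rcases ht with ht | ht
  · rw [abs_of_nonpos (by linarith)]; linarith
  · exact ht.le.trans (le_abs_self t)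

theorem integrable_cutGauss (a : ℝ) {ε : ℝ} (hε : 0 < ε) : Integrable (cutGauss a ε) := by
  refine Integrable.mono' (g := fun t => Real.exp (-(1 / (2 * ε)) * t ^ 2))
    (integrable_exp_neg_mul_sq (by positivity))
    (continuous_cutGauss a ε).aestronglyMeasurable (Filter.Eventually.of_forall fun t => ?_)
  rw [Real.norm_of_nonneg (cutGauss_nonneg a ε t)]
  exact cutGauss_le a ε t

/-- The cutoff removes a relative mass of order `ε`, the second moment of the Gaussian. -/
theorem cutMass_ge_sub {a ε : ℝ} (ha : 0 < a) (hε : 0 < ε) :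
    Real.sqrt ε * (Real.sqrt (2 * Real.pi) * (1 - ε / a ^ 2)) ≤ cutMass a ε := by
  have hb : 0 < 1 / (2 * ε) := by positivity
  have i0 := integrable_exp_neg_mul_sq hb
  have i2 := integrable_pow_mul_exp hb 2
  have h0 : ∫ t : ℝ, Real.exp (-(1 / (2 * ε)) * t ^ 2) = Real.sqrt ε * Real.sqrt (2 * Real.pi) := by
    rw [integral_gaussian, ← Real.sqrt_mul hε.le]
    congr 1
    field_simp
  have h2 : ∫ t : ℝ, t ^ 2 * Real.exp (-(1 / (2 * ε)) * t ^ 2)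
      = ε * (Real.sqrt ε * Real.sqrt (2 * Real.pi)) := by
    have := integral_pow_succ_mul_exp hb 1
    simp only [Nat.sub_self, pow_zero, one_mul, Nat.cast_one] at this
    rw [this, h0]
    field_simp
  rw [cutMass_eq_integral ha]
  have h3 : ∫ t : ℝ, (Real.exp (-(1 / (2 * ε)) * t ^ 2)
      - 1 / a ^ 2 * (t ^ 2 * Real.exp (-(1 / (2 * ε)) * t ^ 2)))
      = Real.sqrt ε * (Real.sqrt (2 * Real.pi) * (1 - ε / a ^ 2)) := by
    rw [integral_sub i0 (i2.const_mul _), integral_const_mul, h0, h2]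
    ring
  rw [← h3]
  refine integral_mono (i0.sub (i2.const_mul _)) (integrable_cutGauss a hε) fun t => ?_
  have := mul_le_mul_of_nonneg_left (le_max_right 0 (1 - t ^ 2 / a ^ 2))
    (Real.exp_pos (-(1 / (2 * ε)) * t ^ 2)).le
  simp only [cutGauss]
  refine le_trans (le_of_eq ?_) this
  ring

theorem cutMass_ge {a ε : ℝ} (ha : 0 < a) (hε : 0 < ε) (hε1 : ε < 1) :
    Real.sqrt ε * (3 / 4 * a * Real.exp (-(a ^ 2 / 8))) ≤ cutMass a ε := by
  set w := a * Real.sqrt ε / 2 with hw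
  have hs : 0 < Real.sqrt ε := Real.sqrt_pos.2 hε
  have hw0 : 0 < w := by positivity
  have hs2 : Real.sqrt ε ^ 2 = ε := Real.sq_sqrt hε.le
  rw [cutMass_eq_integral ha]
  have h1 : ∫ t in Set.Icc (-w) w, (3 / 4 * Real.exp (-(a ^ 2 / 8)))
      = Real.sqrt ε * (3 / 4 * a * Real.exp (-(a ^ 2 / 8))) := by
    rw [setIntegral_const, measureReal_def, Real.volume_Icc, ENNReal.toReal_ofReal (by linarith),
      smul_eq_mul, hw]
    ring
  rw [← h1]
  refine le_trans (setIntegral_mono_on continuous_const.integrableOn_Icc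
    (integrable_cutGauss a hε).integrableOn
    measurableSet_Icc fun t ht => ?_)
    (setIntegral_le_integral (integrable_cutGauss a hε)
      (Filter.Eventually.of_forall (cutGauss_nonneg a ε)))
  have ht2 : t ^ 2 ≤ a ^ 2 * ε / 4 := by
    have := sq_le_sq' ht.1 ht.2
    calc t ^ 2 ≤ w ^ 2 := this
      _ = _ := by rw [hw, div_pow, mul_pow, hs2]; norm_num
  have e1 : 3 / 4 ≤ max 0 (1 - t ^ 2 / a ^ 2) := by
    refine le_trans ?_ (le_max_right _ _)
    have : t ^ 2 / a ^ 2 ≤ 1 / 4 := by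
      rw [div_le_iff₀ (by positivity)]
      nlinarith [sq_pos_of_pos ha]
    linarith
  have e2 : Real.exp (-(a ^ 2 / 8)) ≤ Real.exp (-(1 / (2 * ε)) * t ^ 2) := by
    apply Real.exp_le_exp.2
    have : 1 / (2 * ε) * t ^ 2 ≤ 1 / (2 * ε) * (a ^ 2 * ε / 4) := by gcongr
    have e : 1 / (2 * ε) * (a ^ 2 * ε / 4) = a ^ 2 / 8 := by field_simp; norm_num
    linarith
  rw [cutGauss, mul_comm (3 / 4)]
  gcongr

theorem cutMass_pos {a ε : ℝ} (ha : 0 < a) (hε : 0 < ε) (hε1 : ε < 1) : 0 < cutMass a ε :=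
  lt_of_lt_of_le (by have := Real.sqrt_pos.2 hε; positivity) (cutMass_ge ha hε hε1)

/-- The Dirichlet energy of the profile, relative to that of the error function. -/
theorem exists_div_cutMass_sq_le {a : ℝ} (ha : 0 < a) : ∃ c : ℝ, 0 ≤ c ∧ ∀ ε : ℝ, 0 < ε → ε < 1 →
    2 * Real.pi * ε / cutMass a ε ^ 2 ≤ 1 + c * ε := by
  set κ := 3 / 4 * a * Real.exp (-(a ^ 2 / 8)) with hκ
  have hκ0 : 0 < κ := by positivity
  refine ⟨4 * Real.pi / (a ^ 2 * κ ^ 2), by positivity, fun ε hε hε1 => ?_⟩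
  have hs := Real.sqrt_pos.2 hε
  have hs2 : Real.sqrt ε ^ 2 = ε := Real.sq_sqrt hε.le
  set F := cutMass a ε / Real.sqrt ε with hF
  have hm : cutMass a ε = Real.sqrt ε * F := by rw [hF]; field_simp
  have h1 : κ ≤ F := by rw [hF, le_div_iff₀ hs, mul_comm]; exact cutMass_ge ha hε hε1
  have h2 : Real.sqrt (2 * Real.pi) * (1 - ε / a ^ 2) ≤ F := by
    rw [hF, le_div_iff₀ hs, mul_comm]; exact cutMass_ge_sub ha hε
  have hF0 : 0 < F := hκ0.trans_le h1
  set p := Real.sqrt (2 * Real.pi) with hp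
  have hp0 : 0 < p := Real.sqrt_pos.2 (by positivity)
  have hp2 : p ^ 2 = 2 * Real.pi := Real.sq_sqrt (by positivity)
  have h3 : p ^ 2 - F ^ 2 ≤ 4 * Real.pi * ε / a ^ 2 := by
    have e : 4 * Real.pi * ε / a ^ 2 = 2 * (p * (p * (ε / a ^ 2))) := by
      rw [← mul_assoc p p, ← sq, hp2]; ring
    rw [e]
    set d := p * (ε / a ^ 2) with hd
    have hd0 : 0 ≤ d := by positivity
    have : p - F ≤ d := by rw [hd]; linarith
    nlinarith [sq_nonneg (p - F)]
  have e4 : 2 * Real.pi * ε / cutMass a ε ^ 2 = 1 + (p ^ 2 - F ^ 2) / F ^ 2 := by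
    rw [hm, mul_pow, hs2, hp2]
    field_simp
    ring
  rw [e4]
  have h5 : (p ^ 2 - F ^ 2) / F ^ 2 ≤ (4 * Real.pi * ε / a ^ 2) / F ^ 2 := by gcongr
  have h6 : (4 * Real.pi * ε / a ^ 2) / F ^ 2 ≤ (4 * Real.pi * ε / a ^ 2) / κ ^ 2 := by gcongr
  have e7 : (4 * Real.pi * ε / a ^ 2) / κ ^ 2 = 4 * Real.pi / (a ^ 2 * κ ^ 2) * ε := by
    field_simp
  linarith

theorem antitone_profile {a ε : ℝ} (hm : 0 ≤ cutMass a ε) : Antitone (profile a ε) :=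
  antitone_of_deriv_nonpos (fun t => (hasDerivAt_profile a ε t).differentiableAt) fun t => by
    rw [(hasDerivAt_profile a ε t).deriv]
    exact neg_nonpos.2 (div_nonneg (cutGauss_nonneg a ε t) hm)

theorem abs_profile_le {a ε : ℝ} (ha : 0 < a) (hm : 0 < cutMass a ε) (t : ℝ) :
    |profile a ε t| ≤ 1 := by
  have h1 := antitone_profile hm.le (min_le_left t (-a))
  rw [profile_of_le ha (min_le_right _ _)] at h1
  have h2 := antitone_profile hm.le (le_max_left t a)
  rw [profile_of_ge ha hm.ne' (le_max_right _ _)] at h2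
  rw [abs_le]
  constructor <;> linarith

/-! ### The test function and the capacity -/

section

variable {L ε : ℝ} {N : ℕ}

/-- The test function depends on the mean of the field only. -/
def testFun (a ε : ℝ) {N : ℕ} (z : State N) : ℝ := profile a ε (z (zeroFreq N))

/-- The gradient of `testFun`. -/
def testGrad (a ε : ℝ) {N : ℕ} (z : State N) : State N :=
  EuclideanSpace.single (zeroFreq N) (-(cutGauss a ε (z (zeroFreq N)) / cutMass a ε))

theorem continuous_profile (a ε : ℝ) : Continuous (profile a ε) :=
  continuous_iff_continuousAt.2 fun t => (hasDerivAt_profile a ε t).continuousAt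

theorem continuous_testFun (a ε : ℝ) : Continuous (testFun a ε : State N → ℝ) :=
  (continuous_profile a ε).comp (by fun_prop)

theorem testGrad_eq_smul (a ε : ℝ) (z : State N) : testGrad a ε z
    = (-(cutGauss a ε (z (zeroFreq N)) / cutMass a ε)) •
      EuclideanSpace.single (zeroFreq N) (1 : ℝ) := by
  rw [testGrad]
  ext k
  by_cases hk : k = zeroFreq N <;> simp [hk]

theorem continuous_testGrad (a ε : ℝ) : Continuous (testGrad a ε : State N → State N) := by
  have : (testGrad a ε : State N → State N) = fun z => _ := funext (testGrad_eq_smul a ε)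
  rw [this]
  fun_prop

theorem hasFDerivAt_testFun (a ε : ℝ) (z : State N) :
    HasFDerivAt (testFun a ε : State N → ℝ) (innerSL ℝ (testGrad a ε z)) z := by
  have h1 : HasFDerivAt (fun z : State N => z (zeroFreq N))
      (EuclideanSpace.proj (zeroFreq N) : State N →L[ℝ] ℝ) z :=
    (EuclideanSpace.proj (zeroFreq N) : State N →L[ℝ] ℝ).hasFDerivAt
  have h2 := (hasDerivAt_profile a ε (z (zeroFreq N))).comp_hasFDerivAt z h1
  refine h2.congr_fderiv ?_
  ext v
  simp [testGrad, EuclideanSpace.inner_single_left]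

theorem hasWeakGradient_testFun (a ε : ℝ) :
    HasWeakGradient (testFun a ε : State N → ℝ) (testGrad a ε) := by
  refine ⟨(continuous_testFun a ε).locallyIntegrable, (continuous_testGrad a ε).locallyIntegrable,
    fun ψ hψ hc v => ?_⟩
  have hψ1 : Continuous (fun x => fderiv ℝ ψ x v) :=
    (hψ.continuous_fderiv (by simp)).clm_apply continuous_const
  have hc1 : HasCompactSupport (fun x => fderiv ℝ ψ x v) :=
    (hc.fderiv ℝ).comp_left (g := fun (l : State N →L[ℝ] ℝ) => l v) (by simp)
  have hd : ∀ x, fderiv ℝ (testFun a ε : State N → ℝ) x v =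
      inner ℝ (testGrad a ε x) v := fun x => by
    rw [(hasFDerivAt_testFun a ε x).fderiv]; rfl
  have hcd : Continuous fun x : State N => inner ℝ (testGrad a ε x) v :=
    (continuous_testGrad a ε).inner continuous_const
  have h := integral_mul_fderiv_eq_neg_fderiv_mul_of_integrable (μ := (volume : Measure (State N)))
    (f := (testFun a ε : State N → ℝ)) (g := ψ) (v := v) ?_ ?_ ?_
    (fun x _ => (hasFDerivAt_testFun a ε x).differentiableAt)
    (fun x _ => (hψ.differentiable (by simp)) x)
  · rw [h]
    simp only [hd, mul_comm]
  · simp only [hd]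
    exact (hcd.mul hψ.continuous).integrable_of_hasCompactSupport hc.mul_left
  · exact ((continuous_testFun a ε).mul hψ1).integrable_of_hasCompactSupport hc1.mul_left
  · exact ((continuous_testFun a ε).mul hψ.continuous).integrable_of_hasCompactSupport hc.mul_left

/-- The quartic term dominates the unstable quadratic direction. -/
theorem exists_mul_wick_ge (hL0 : 0 < L) (hε : 0 < ε) (N : ℕ) :
    ∃ c : ℝ, ∀ y : State N, y (zeroFreq N) ^ 2 - c ≤ ε * wick L y := by
  set C := renormConst L N
  set K := (4 / ε + 6 * C) ^ 2 / 4 with hK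
  refine ⟨ε / 4 * (K * L ^ 2), fun y => ?_⟩
  have h1 : torusIntegral L (fun p => 4 / ε * field L y p ^ 2 - K)
      = 4 / ε * ∑ k, ‖coef y k‖ ^ 2 - K * L ^ 2 := by
    rw [torusIntegral_eq, integral_sub (Continuous.integrable_torusMeasure (by fun_prop) L)
      (integrable_const _), integral_const_mul, ← torusIntegral_eq, integral_field_sq hL0,
      integral_const, torusMeasure_real_univ hL0.le, smul_eq_mul]
    ring
  have h2 : torusIntegral L (fun p => 4 / ε * field L y p ^ 2 - K) ≤ torusIntegral L (fun p =>
      field L y p ^ 4 - 6 * C * field L y p ^ 2 + 3 * C ^ 2) := by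
    rw [torusIntegral_eq, torusIntegral_eq]
    refine integral_mono (Continuous.integrable_torusMeasure (by fun_prop) L)
      (Continuous.integrable_torusMeasure (by fun_prop) L) fun p => ?_
    have := sq_nonneg (field L y p ^ 2 - (4 / ε + 6 * C) / 2)
    have h3 := sq_nonneg C
    simp only [hK]
    nlinarith
  have h3 : y (zeroFreq N) ^ 2 ≤ ∑ k, ‖coef y k‖ ^ 2 := by
    rw [← norm_coef_zeroFreq]
    exact Finset.single_le_sum (f := fun k => ‖coef y k‖ ^ 2) (fun k _ => by positivity)
      (Finset.mem_univ (zeroFreq N))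
  rw [h1] at h2
  have h4 : ε * wick L y = ε / 4 * torusIntegral L (fun p =>
      field L y p ^ 4 - 6 * C * field L y p ^ 2 + 3 * C ^ 2) := by
    rw [wick]; ring
  rw [h4]
  have h5 := mul_le_mul_of_nonneg_left h2 (by positivity : 0 ≤ ε / 4)
  have e5 : ε / 4 * (4 / ε * ∑ k, ‖coef y k‖ ^ 2 - K * L ^ 2)
      = ∑ k, ‖coef y k‖ ^ 2 - ε / 4 * (K * L ^ 2) := by
    field_simp
  linarith

variable (hL0 : 0 < L) (hL : L < 2 * Real.pi) (hε : 0 < ε)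
include hL0 hL hε

theorem potential_div_eq (z : State N) : potential L ε z / ε
    = quadForm L ((Real.sqrt ε)⁻¹ • z) - ((Real.sqrt ε)⁻¹ • z) (zeroFreq N) ^ 2
      + ε * wick L ((Real.sqrt ε)⁻¹ • z) := by
  rw [← potential_sqrt_smul hL0 hL hε, smul_inv_smul₀ (Real.sqrt_pos.2 hε).ne']

theorem continuous_exp_neg_potential :
    Continuous fun z : State N => Real.exp (-potential L ε z / ε) := by
  simp only [neg_div, potential_div_eq hL0 hL hε]
  have h1 : Continuous fun z : State N => quadForm L ((Real.sqrt ε)⁻¹ • z) :=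
    (continuous_quadForm L).comp (continuous_const_smul _)
  have h2 : Continuous fun z : State N => wick L ((Real.sqrt ε)⁻¹ • z) :=
    (continuous_wick L).comp (continuous_const_smul _)
  fun_prop

theorem isFiniteMeasure_gibbs : IsFiniteMeasure (gibbs L ε N) := by
  obtain ⟨c, hc⟩ := exists_mul_wick_ge hL0 hε N
  have hs : (Real.sqrt ε)⁻¹ ≠ 0 := inv_ne_zero (Real.sqrt_pos.2 hε).ne'
  have h1 : Integrable fun z : State N =>
      Real.exp c * Real.exp (-quadForm L ((Real.sqrt ε)⁻¹ • z)) :=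
    ((integrable_exp_neg_quadForm hL0 hL).comp_smul hs).const_mul _
  refine isFiniteMeasure_withDensity_ofReal (Integrable.hasFiniteIntegral (h1.mono' ?_ ?_))
  · exact (continuous_exp_neg_potential hL0 hL hε).aestronglyMeasurable
  · refine Filter.Eventually.of_forall fun z => ?_
    rw [Real.norm_of_nonneg (Real.exp_pos _).le, ← Real.exp_add, neg_div,
      potential_div_eq hL0 hL hε]
    apply Real.exp_le_exp.2
    have := hc ((Real.sqrt ε)⁻¹ • z)
    linarith

theorem isAdmissible_testFun {a : ℝ} (ha : 0 < a) (hε1 : ε < 1) {A B : Set (State N)}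
    (hA : ∀ z ∈ A, z (zeroFreq N) ≤ -a) (hB : ∀ z ∈ B, a ≤ z (zeroFreq N)) :
    IsAdmissible L ε A B (testFun a ε) (testGrad a ε) := by
  have hfin := isFiniteMeasure_gibbs (N := N) hL0 hL hε
  have hm := cutMass_pos ha hε hε1
  refine ⟨hasWeakGradient_testFun a ε, ?_, ?_, Filter.Eventually.of_forall fun z hz =>
    profile_of_le ha (hA z hz), Filter.Eventually.of_forall fun z hz =>
    profile_of_ge ha hm.ne' (hB z hz)⟩
  · exact MemLp.of_bound (continuous_testFun a ε).aestronglyMeasurable 1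
      (Filter.Eventually.of_forall fun z => abs_profile_le ha hm _)
  · refine MemLp.of_bound (continuous_testGrad a ε).aestronglyMeasurable (1 / cutMass a ε)
      (Filter.Eventually.of_forall fun z => ?_)
    rw [testGrad, PiLp.norm_single, norm_neg, Real.norm_of_nonneg
      (div_nonneg (cutGauss_nonneg _ _ _) hm.le)]
    gcongr
    refine (cutGauss_le _ _ _).trans (Real.exp_le_one_iff.2 ?_)
    have : 0 ≤ 1 / (2 * ε) * (z (zeroFreq N)) ^ 2 := by positivity
    linarith

/-- The energy of the test function: the squared derivative of the profile turns the unstable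
Gaussian factor of the Gibbs weight into a stable one, and the rescaling `z = √ε y` produces the
expectation of `e^{-ε w_N}` under the Gaussian measure. -/
theorem lintegral_testGrad_le (a : ℝ) :
    ∫⁻ z : State N, ENNReal.ofReal (‖testGrad a ε z‖ ^ 2) ∂(gibbs L ε N) ≤
      ENNReal.ofReal (1 / cutMass a ε ^ 2 * (Real.sqrt ε ^ Fintype.card (Freq N) *
        ((∫ y : State N, Real.exp (-quadForm L y)) *
          ∫ y, Real.exp (-ε * wick L y) ∂(gauss L N)))) := by
  have hs := Real.sqrt_pos.2 hε
  have hs2 : Real.sqrt ε ^ 2 = ε := Real.sq_sqrt hε.le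
  set H : State N → ℝ := fun y => Real.exp (-ε * wick L y) * Real.exp (-quadForm L y) with hH
  have hHint : Integrable H :=
    (integrable_gauss_iff hL0 hL).1 (integrable_exp_neg_mul_wick hL0 hL hε.le)
  have hH2 : ∫ z : State N, 1 / cutMass a ε ^ 2 * H ((Real.sqrt ε)⁻¹ • z)
      = 1 / cutMass a ε ^ 2 * (Real.sqrt ε ^ Fintype.card (Freq N) *
        ((∫ y : State N, Real.exp (-quadForm L y)) *
          ∫ y, Real.exp (-ε * wick L y) ∂(gauss L N))) := by
    rw [integral_const_mul, Measure.integral_comp_inv_smul_of_nonneg _ _ hs.le,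
      integral_gauss hL0 hL, mul_inv_cancel_left₀ (integral_exp_neg_quadForm_pos hL0 hL).ne',
      finrank_euclideanSpace,
      smul_eq_mul]
  have hHi : Integrable fun z : State N => 1 / cutMass a ε ^ 2 * H ((Real.sqrt ε)⁻¹ • z) :=
    (hHint.comp_smul (inv_ne_zero hs.ne')).const_mul _
  rw [← hH2, ofReal_integral_eq_lintegral_ofReal hHi
    (Filter.Eventually.of_forall fun z => by positivity), gibbs,
    lintegral_withDensity_eq_lintegral_mul _
      (continuous_exp_neg_potential hL0 hL hε).measurable.ennreal_ofReal
      (show Continuous fun z : State N => ‖testGrad a ε z‖ ^ 2 from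
        (continuous_testGrad a ε).norm.pow 2).measurable.ennreal_ofReal]
  refine lintegral_mono fun z => ?_
  rw [Pi.mul_apply, ← ENNReal.ofReal_mul (Real.exp_pos _).le]
  apply ENNReal.ofReal_le_ofReal
  set t := z (zeroFreq N) with ht
  have h1 : ‖testGrad a ε z‖ ^ 2 ≤ 1 / cutMass a ε ^ 2 * Real.exp (-(t ^ 2 / ε)) := by
    rw [testGrad, PiLp.norm_single, norm_neg, Real.norm_eq_abs, sq_abs, div_pow,
      div_eq_mul_one_div, mul_comm]
    refine mul_le_mul_of_nonneg_left ?_ (by positivity)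
    have e : Real.exp (-(t ^ 2 / ε)) = Real.exp (-(1 / (2 * ε)) * t ^ 2) ^ 2 := by
      rw [← Real.exp_nat_mul]
      congr 1
      push_cast
      field_simp
    rw [e]
    have := cutGauss_nonneg a ε t
    have := cutGauss_le a ε t
    gcongr
  refine (mul_le_mul_of_nonneg_left h1 (Real.exp_pos _).le).trans (le_of_eq ?_)
  rw [mul_left_comm, hH]
  beta_reduce
  rw [← Real.exp_add, ← Real.exp_add, neg_div, potential_div_eq hL0 hL hε]
  congr 2
  have : ((Real.sqrt ε)⁻¹ • z) (zeroFreq N) ^ 2 = t ^ 2 / ε := by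
    simp only [PiLp.smul_apply, smul_eq_mul, mul_pow, inv_pow, hs2]
    rw [ht]; ring
  rw [this]
  ring

theorem capacity_le_of_mean {a : ℝ} (ha : 0 < a) (hε1 : ε < 1) {A B : Set (State N)}
    (hA : ∀ z ∈ A, z (zeroFreq N) ≤ -a) (hB : ∀ z ∈ B, a ≤ z (zeroFreq N)) :
    capacity L ε A B ≤ ENNReal.ofReal (Real.sqrt (|lam L 0| * ε / (2 * Real.pi)) *
      (∏ k ∈ (freqs N).erase 0, Real.sqrt (2 * Real.pi * ε / lam L k)) *
      (2 * Real.pi * ε / cutMass a ε ^ 2 * ∫ y, Real.exp (-ε * wick L y) ∂(gauss L N))) := by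
  have h1 : capacity L ε A B ≤ ENNReal.ofReal ε *
      ∫⁻ z : State N, ENNReal.ofReal (‖testGrad a ε z‖ ^ 2) ∂(gibbs L ε N) := by
    unfold capacity
    refine mul_le_mul_right ?_ _
    exact iInf_le_of_le (testFun a ε) (iInf_le_of_le (testGrad a ε) (iInf_le_of_le
      (isAdmissible_testFun hL0 hL hε ha hε1 hA hB) (setLIntegral_le_lintegral _ _)))
  refine h1.trans ((mul_le_mul_right (lintegral_testGrad_le hL0 hL hε a) _).trans (le_of_eq ?_))
  rw [← ENNReal.ofReal_mul hε.le]
  congr 1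
  rw [integral_exp_neg_quadForm hL0 hL, lam_zero]
  have hcard : Fintype.card (Freq N) = ((freqs N).erase 0).card + 1 := by
    rw [Finset.card_erase_add_one (show (0 : ℤ × ℤ) ∈ freqs N from (zeroFreq N).2)]
    simp
  have hprod : ∏ k ∈ (freqs N).erase 0, Real.sqrt (2 * Real.pi * ε / lam L k)
      = Real.sqrt ε ^ ((freqs N).erase 0).card
        * ∏ k ∈ (freqs N).erase 0, Real.sqrt (2 * Real.pi / lam L k) := by
    rw [← Finset.prod_const, ← Finset.prod_mul_distrib]
    refine Finset.prod_congr rfl fun k _ => ?_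
    rw [← Real.sqrt_mul hε.le]
    congr 1
    ring
  rw [hcard, hprod, pow_succ]
  have e1 : Real.sqrt (|(-1 : ℝ)| * ε / (2 * Real.pi)) * (2 * Real.pi)
      = Real.sqrt ε * Real.sqrt (2 * Real.pi) := by
    rw [abs_neg, abs_one, one_mul, Real.sqrt_div hε.le]
    have := Real.sq_sqrt (show (0 : ℝ) ≤ 2 * Real.pi by positivity)
    have h0 : 0 < Real.sqrt (2 * Real.pi) := Real.sqrt_pos.2 (by positivity)
    rw [div_mul_eq_mul_div, div_eq_iff h0.ne']
    linear_combination (-Real.sqrt ε) * this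
  linear_combination (-(ε / cutMass a ε ^ 2 * Real.sqrt ε ^ ((freqs N).erase 0).card
    * (∏ k ∈ (freqs N).erase 0, Real.sqrt (2 * Real.pi / lam L k))
    * ∫ y, Real.exp (-ε * wick L y) ∂(gauss L N))) * e1

end

end

end AllenCahn

theorem proposition4p2 (L : ℝ) (hL0 : 0 < L) (hL : L < 2 * Real.pi) :
    (∃ C : ℝ, ∀ N : ℕ, ∀ ε : ℝ, 0 < ε → ε < 1 →
      Integrable (fun y : AllenCahn.State N => Real.exp (-ε * AllenCahn.wick L y))
          (AllenCahn.gauss L N) ∧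
        |∫ y, Real.exp (-ε * AllenCahn.wick L y) ∂(AllenCahn.gauss L N) - 1| ≤ C * ε) ∧
    (∀ δ s r : ℝ, 0 < δ → δ < 1 → s < 0 → 0 < r →
      ∃ c : ℝ, ∀ N : ℕ, ∀ ε : ℝ, 0 < ε → ε < 1 →
        AllenCahn.capacity L ε (AllenCahn.setA L δ s r ε N) (AllenCahn.setB L δ s r ε N) ≤
          ENNReal.ofReal
            (Real.sqrt (|AllenCahn.lam L 0| * ε / (2 * Real.pi)) *
              (∏ k ∈ (AllenCahn.freqs N).erase 0,
                Real.sqrt (2 * Real.pi * ε / AllenCahn.lam L k)) *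
              (1 + c * ε))) := by
  obtain ⟨C, hC0, hC⟩ := AllenCahn.exists_integral_exp_neg_mul_wick hL0 hL
  refine ⟨⟨C, hC⟩, fun δ s r hδ hδ1 _ _ => ?_⟩
  -- on `A` and `B` the zero mode, which is `L` times the mean, is at distance `a` from the origin
  set a := L * (1 - δ) with ha
  have ha0 : 0 < a := mul_pos hL0 (by linarith)
  obtain ⟨c, hc0, hc⟩ := AllenCahn.exists_div_cutMass_sq_le ha0
  refine ⟨c + C + c * C, fun N ε hε hε1 => ?_⟩
  have hA : ∀ z ∈ AllenCahn.setA L δ s r ε N, z (AllenCahn.zeroFreq N) ≤ -a := by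
    intro z hz
    have := hz.1.2
    rw [AllenCahn.mean_field hL0, div_le_iff₀ hL0] at this
    rw [ha]; linarith
  have hB : ∀ z ∈ AllenCahn.setB L δ s r ε N, a ≤ z (AllenCahn.zeroFreq N) := by
    intro z hz
    have := hz.1.1
    rw [AllenCahn.mean_field hL0, le_div_iff₀ hL0] at this
    rw [ha]; linarith
  refine (AllenCahn.capacity_le_of_mean hL0 hL hε ha0 hε1 hA hB).trans
    (ENNReal.ofReal_le_ofReal (mul_le_mul_of_nonneg_left ?_ (by positivity)))
  have h1 := hc ε hε hε1
  have h2 := (abs_le.1 (hC N ε hε hε1).2).2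
  have h3 : 0 ≤ ∫ y, Real.exp (-ε * AllenCahn.wick L y) ∂(AllenCahn.gauss L N) :=
    integral_nonneg fun y => (Real.exp_pos _).le
  calc _ ≤ (1 + c * ε) * (1 + C * ε) :=
        mul_le_mul h1 (by linarith) h3 (by positivity)
    _ = 1 + (c + C) * ε + c * C * (ε * ε) := by ring
    _ ≤ 1 + (c + C) * ε + c * C * (ε * 1) := by gcongr
    _ = _ := by ring
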